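/- Let $\Phi$ be an irreducible, crystallographic, possibly non-reduced finite root system spanning a Euclidean space $\mathfrak a$, let $(\alpha_i)_{i\in I_0}$ be a base, $\Phi^+$ the positive roots, $\alpha^\vee=2\alpha/\langle\alpha,\alpha\rangle$, and let $\Phi^{++}$ be the set of $\alpha\in\Phi^+$ with $\frac12\alpha\notin\Phi^+$. Let $(\lambda_i)_{i\in I_0}$ be the fundamental co-weights (the basis of $\mathfrak a$ dual to $(\alpha_i)$) and $P=\bigoplus_i\mathbb Z\lambda_i$; a co-weight $\lambda=\sum_i x_i\lambda_i\in P$ is dominant if all $x_i\ge 0$. For $J\subseteq I_0$ let $\Phi_J=\{\alpha\in\Phi:\langle\alpha,\lambda_k\rangle=0\text{ for all }k\notin J\}$, $\Phi_J^{+}=\Phi_J\cap\Phi^{+}$, $\Phi_J^{++}=\Phi_J\cap\Phi^{++}$, and let $W_J$ be the group generated by the orthogonal reflections in $\alpha_j^\perp$, $j\in J$; $W=W_{I_0}$ is the Weyl group. Let $(q_\alpha)_{\alpha\in\Phi}$ be real numbers, $q_\alpha>1$, with $q_{w\alpha}=q_\alpha$ for $w\in W$. For a vector $\alpha$ put $\tau_\alpha=1$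 if $\alpha\notin\Phi$; $\tau_\alpha=q_\alpha$ if $\alpha\in\Phi$ and either $\frac12\alpha\in\Phi$ or $2\alpha\notin\Phi$; and $\tau_\alpha=q_\alpha q_{2\alpha}^{-1}$ if $\alpha,2\alpha\in\Phi$. Define $$\mathbf c_J(\theta)=\prod_{\alpha\in\Phi_J^{++}}\frac{\bigl(1-\tau_{2\alpha}^{-1}\tau_\alpha^{-1/2}e^{-\frac12\langle\theta,\alpha^\vee\rangle}\bigr)\bigl(1+\tau_\alpha^{-1/2}e^{-\frac12\langle\theta,\alpha^\vee\rangle}\bigr)}{1-e^{-\langle\theta,\alpha^\vee\rangle}},$$ $$\mathcal P_J(\mu)=\lim_{\theta\to0}\frac1{|W_J|}\sum_{w\in W_J}e^{\langle w\theta,\mu\rangle}\mathbf c_J(w\theta),\qquad \mu\in P,$$ where $\theta\to 0$ through the points of $\mathfrak a$ with $\langle\theta,\alpha^\vee\rangle\ne0$ for all $\alpha\in\Phi_J$, and write $\mathcal P=\mathcal P_{I_0}$. Then the limits $\mathcal P_J(\mu)$ exist for all $J\subseteq I_0$ and $\mu\in P$, and the following holds. For every $J\subsetneq I_0$ there is a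 constant $a_J>0$ such that for every sequence $(\gamma_n)_{n\in\mathbb N}$ of dominant co-weights with $$\sup_n\langle\gamma_n,\alpha\rangle<\infty\ \text{ for all }\alpha\in\Phi_J^+,\qquad \lim_{n\to\infty}\langle\gamma_n,\alpha\rangle=+\infty\ \text{ for all }\alpha\in\Phi^+\setminus\Phi_J^+,$$ one has, as $n\to\infty$, $$\mathcal P(\gamma_n)=\Bigl(\prod_{\alpha\in\Phi^{++}\setminus\Phi_J}\langle\gamma_n,\alpha^\vee\rangle\Bigr)\,\mathcal P_J(\gamma_n)\,\bigl(a_J+o(1)\bigr).$$ -/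

import Mathlib

open Filter Topology

noncomputable section

namespace GroundState

variable {ι E I : Type*} [NormedAddCommGroup E] [InnerProductSpace ℝ E]

/-- The root pairing lives in the Euclidean space `E`: roots and coroots are both vectors of `E`,
paired by the inner product, and the coroot of `α` is `α^∨ = 2 α / ⟨α, α⟩`. -/
def IsEuclidean (R : RootPairing ι ℝ E E) : Prop :=
  (∀ x y : E, R.toLinearMap x y = inner ℝ x y) ∧
    ∀ i, R.coroot i = (2 / inner ℝ (R.root i) (R.root i)) • R.root i

/-- A base `(α_k)_{k ∈ I}` of a possibly non-reduced root system: the simple roots form a basis of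
`E`, and every root is a combination of simple roots with coefficients in `ℕ`, or the negative of
such a combination. (`RootPairing.Base` also constrains the coroots, which excludes the
non-reduced systems.) -/
structure SimpleRoots (R : RootPairing ι ℝ E E) (I : Type*) where
  idx : I → ι
  basis : Module.Basis I ℝ E
  basis_apply : ∀ k, basis k = R.root (idx k)
  pos_or_neg : ∀ i, R.root i ∈ AddSubmonoid.closure (Set.range basis) ∨
    -R.root i ∈ AddSubmonoid.closure (Set.range basis)

variable {R : RootPairing ι ℝ E E}

/-- `i` indexes a positive root, that is `α_i ∈ Φ⁺`. -/
def SimpleRoots.IsPos (b : SimpleRoots R I) (i : ι) : Prop :=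
  R.root i ∈ AddSubmonoid.closure (Set.range b.basis)

/-- `i` indexes an element of `Φ⁺⁺`: a positive root `α` such that `α / 2` is not a positive
root. -/
def SimpleRoots.IsPosIndiv (b : SimpleRoots R I) (i : ι) : Prop :=
  b.IsPos i ∧ ¬ ∃ j, b.IsPos j ∧ R.root j = (1 / 2 : ℝ) • R.root i

/-- The fundamental coweights `λ_k`: the basis of `E` dual to the simple roots. -/
def SimpleRoots.coweight [FiniteDimensional ℝ E] (b : SimpleRoots R I) (k : I) : E :=
  (InnerProductSpace.toDual ℝ E).symm (LinearMap.toContinuousLinearMap (b.basis.coord k))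

lemma SimpleRoots.inner_coweight [FiniteDimensional ℝ E] [DecidableEq I] (b : SimpleRoots R I)
    (k l : I) : inner ℝ (b.coweight k) (R.root (b.idx l)) = if k = l then (1 : ℝ) else 0 := by
  rw [← b.basis_apply, SimpleRoots.coweight, InnerProductSpace.toDual_symm_apply]
  simp [Finsupp.single_apply, eq_comm]

/-- The coweight lattice `P`. -/
def SimpleRoots.coweightLattice [FiniteDimensional ℝ E] (b : SimpleRoots R I) :
    Submodule ℤ E :=
  Submodule.span ℤ (Set.range b.coweight)

/-- Dominant coweights: the elements of `P` with non-negative coordinates in the basis of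
fundamental coweights. -/
def SimpleRoots.IsDominant [FiniteDimensional ℝ E] [Fintype I] (b : SimpleRoots R I)
    (x : E) : Prop :=
  x ∈ b.coweightLattice ∧ ∃ c : I → ℝ, (∀ k, 0 ≤ c k) ∧ x = ∑ k, c k • b.coweight k

/-- `i` indexes an element of `Φ_J`: a root orthogonal to all `λ_k` with `k ∉ J`. -/
def SimpleRoots.Mem [FiniteDimensional ℝ E] (b : SimpleRoots R I) (J : Finset I) (i : ι) : Prop :=
  ∀ k, k ∉ J → inner ℝ (R.root i) (b.coweight k) = (0 : ℝ)

/-- The parabolic subgroup `W_J ≤ GL(E)` generated by the simple reflections `r_j`, `j ∈ J`.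
For `J = I` it is the Weyl group `W`. -/
def SimpleRoots.weyl (b : SimpleRoots R I) (J : Finset I) : Subgroup (E ≃ₗ[ℝ] E) :=
  Subgroup.closure ((fun j => R.reflection (b.idx j)) '' J)

lemma SimpleRoots.weyl_finite [Finite ι] (b : SimpleRoots R I) (J : Finset I) :
    Finite (b.weyl J) := by
  have key : ∀ w ∈ b.weyl J, ∀ i, ∃ j, w (R.root i) = R.root j := by
    intro w hw
    induction hw using Subgroup.closure_induction'' with
    | one => exact fun i => ⟨i, rfl⟩
    | mem x hx =>
      obtain ⟨j, -, rfl⟩ := hx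
      exact fun i => ⟨R.reflectionPerm (b.idx j) i, by simp⟩
    | inv_mem x hx =>
      obtain ⟨j, -, rfl⟩ := hx
      exact fun i => ⟨R.reflectionPerm (b.idx j) i, by simp⟩
    | mul x y _ _ hx hy =>
      intro i
      obtain ⟨j, hj⟩ := hy i
      obtain ⟨k, hk⟩ := hx j
      exact ⟨k, by simp [hj, hk]⟩
  choose f hf using key
  have : Function.Injective (fun w : b.weyl J => f w.1 w.2) := by
    intro v w h
    apply Subtype.ext
    apply LinearEquiv.toLinearMap_injective
    refine b.basis.ext fun k => ?_
    have h1 := hf v.1 v.2 (b.idx k)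
    have h2 := hf w.1 w.2 (b.idx k)
    have h3 := congrFun h (b.idx k)
    simp only at h3
    rw [b.basis_apply]
    simp only [LinearEquiv.coe_coe]
    rw [h1, h2, h3]
  exact Finite.of_injective _ this

/-- A system of parameters `q_α > 1` (`α ∈ Φ`), invariant under the Weyl group.
For `α ∈ Φ⁺⁺` this is the parameter `q_α`; the divisible roots are the conjugates of the highest
root `α₀` when `Φ` is non-reduced, and carry the parameter `q_{α₀}`. -/
structure IsParam (R : RootPairing ι ℝ E E) (q : E → ℝ) : Prop where
  one_lt : ∀ i, 1 < q (R.root i)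
  invariant : ∀ i j, q (R.reflection j (R.root i)) = q (R.root i)

open Classical in
/-- The parameters `τ_α`, defined for all vectors, with `τ_α = 1` when `α` is not a root. -/
def tau (R : RootPairing ι ℝ E E) (q : E → ℝ) (v : E) : ℝ :=
  if v ∉ Set.range R.root then 1
  else if (1 / 2 : ℝ) • v ∈ Set.range R.root then q v
  else if (2 : ℝ) • v ∈ Set.range R.root then q v / q ((2 : ℝ) • v)
  else q v

/-- The factor of the `c`-function at the root `α` with index `i`. -/
def cFactor (R : RootPairing ι ℝ E E) (q : E → ℝ) (i : ι) (θ : E) : ℝ :=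
  (1 - (tau R q ((2 : ℝ) • R.root i))⁻¹ * tau R q (R.root i) ^ (-(1 / 2) : ℝ) *
      Real.exp (-(1 / 2) * inner ℝ θ (R.coroot i))) *
    (1 + tau R q (R.root i) ^ (-(1 / 2) : ℝ) * Real.exp (-(1 / 2) * inner ℝ θ (R.coroot i))) /
    (1 - Real.exp (-inner ℝ θ (R.coroot i)))

open Classical in
/-- The `c`-function `c_J`: the product of the factors over `Φ_J⁺⁺`. -/
def cFun [Fintype ι] [FiniteDimensional ℝ E] (b : SimpleRoots R I) (q : E → ℝ) (J : Finset I)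
    (θ : E) : ℝ :=
  ∏ i with b.IsPosIndiv i ∧ b.Mem J i, cFactor R q i θ

/-- The points where no denominator of `c_J` vanishes; this set is stable under `W_J`. -/
def regular [FiniteDimensional ℝ E] (b : SimpleRoots R I) (J : Finset I) : Set E :=
  {θ | ∀ i, b.Mem J i → inner ℝ θ (R.coroot i) ≠ (0 : ℝ)}

/-- The average `|W_J|⁻¹ ∑_{w ∈ W_J} e^{⟨w θ, μ⟩} c_J(w θ)`; the group `W_J` is finite, so that
`∑ᶠ` is an honest sum. -/
def average [Fintype ι] [FiniteDimensional ℝ E] (b : SimpleRoots R I) (q : E → ℝ) (J : Finset I)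
    (μ θ : E) : ℝ :=
  (Nat.card (b.weyl J) : ℝ)⁻¹ *
    ∑ᶠ w : b.weyl J, Real.exp (inner ℝ (w.1 θ) μ) * cFun b q J (w.1 θ)

/-- `𝒫_J(μ)`: the limit of the averages as `θ → 0` through regular points. -/
def groundP [Fintype ι] [FiniteDimensional ℝ E] (b : SimpleRoots R I) (q : E → ℝ) (J : Finset I)
    (μ : E) : ℝ :=
  limUnder (𝓝[regular b J] 0) (average b q J μ)

end GroundState

end

/-!
The averages are symmetrizations over `W_J` of exponential sums divided by Weyl denominators. Put
`δ_J(x) = ∏ ⟨x, α^∨⟩` over `Φ_J⁺⁺` (`delta`), and multiply the numerator of each factor of the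
`c`-function by `e^{⟨θ, α^∨⟩ / 2}`; this turns it into `e^{u / 2} + p_α - t_α e^{-u / 2}` with
`u = ⟨θ, α^∨⟩`, and the denominator into the odd function `2 sinh (u / 2)`.

*Limits.* The alternating sum `∑ ε(w) e^{⟨w θ, x⟩}` (`altSum`) vanishes on all root hyperplanes in
both variables, so by Hadamard's lemma it is `δ_J(θ) δ_J(x) K(θ, x)` with `K` smooth
(`exists_altSum_eq`). Homogeneity makes `K(0, x)` a constant `c`, and `c > 0` because `e^{⟨x, y⟩}`
is a positive semidefinite kernel (`exists_pos_tendsto_altSum_div`). Expanding the numerators into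
exponentials, the averages converge to a positive multiple of the polynomial
`f_J = ∏ (T_{α^∨/2} + p_α - t_α T_{-α^∨/2}) δ_J` (`groundPoly`), where `T_v` is translation by `v`.
This holds for all vectors `μ`, with no restriction on how `θ` approaches the walls.

*Asymptotics.* The same limit shows that a `W_K`-invariant combination of translations multiplies
`δ_K` by its total mass (`IsInvariant.shift_delta`). For `K ⊆ J` write `δ_J = δ_K δ'`. If the
coordinates in `K` stay bounded and `δ'` becomes large in each of its factors, the translations do
not affect `δ'` to leading order, and the translations belonging to `Φ_J⁺⁺ \ Φ_K` act on `δ_K` by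
the scalar `∏ (1 + p_α - t_α)`. Hence `f_J / δ'` minus this scalar times `f_K` tends to zero
(`tendsto_groundPoly_div_sub`).

*Positivity.* To turn this into the relative asymptotics one needs `f_J > 0` on dominant integral
vectors (`groundPoly_pos`), which is proved by induction on `J`, deforming `(p, t)` to
`(s p, s² t)`. At `s = 0` the polynomial is `δ_J` translated by the half sum of the coroots. The
set of `s` with `f_J ≥ 0` is closed. If `f_J ≥ 0` then `f_J > 0`: averaging over the shortest
coroots `ν` of `Φ_J` gives `∑ f_J(x + ν) = N f_J(x)`, where `N` is their number, and the rank-one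
straightening relations show that at a zero `x` all the summands are non-negative; so zeros
propagate in a dominant direction, against the asymptotics. Finally positivity is an open condition
on `s`, by the asymptotics applied to a hypothetical family of counterexamples, whose coordinates
may be taken to be constant or to tend to infinity.
-/

noncomputable section

namespace GroundState

/-! ### Division of smooth functions by linear forms -/

section Division
open scoped ContDiff

variable {V : Type*} [NormedAddCommGroup V] [NormedSpace ℝ V] [FiniteDimensional ℝ V]

lemma contDiff_integral_unitInterval {g : V × ℝ → ℝ} (hg : ContDiff ℝ ∞ g) :
    ContDiff ℝ ∞ (fun x => ∫ t in (0 : ℝ)..1, g (x, t)) := by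
  rw [contDiff_infty]
  intro n
  induction n generalizing g with
  | zero =>
    rw [Nat.cast_zero, contDiff_zero]
    exact intervalIntegral.continuous_parametric_intervalIntegral_of_continuous'
      (by simpa [Function.uncurry_def] using hg.continuous) 0 1
  | succ n ih =>
    have hd : Differentiable ℝ g := hg.differentiable (by simp)
    have hpart : ∀ x t, HasFDerivAt (fun y => g (y, t))
        ((fderiv ℝ g (x, t)).comp (ContinuousLinearMap.inl ℝ V ℝ)) x := fun x t =>
      (hd (x, t)).hasFDerivAt.comp x (hasFDerivAt_prodMk_left x t)
    have hcont : Continuous fun z : V × ℝ =>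
        (fderiv ℝ g z).comp (ContinuousLinearMap.inl ℝ V ℝ) :=
      (hg.continuous_fderiv (by simp)).clm_comp continuous_const
    have key : ∀ x, HasFDerivAt (fun x => ∫ t in (0 : ℝ)..1, g (x, t))
        (∫ t in (0 : ℝ)..1, (fderiv ℝ g (x, t)).comp (ContinuousLinearMap.inl ℝ V ℝ)) x := by
      intro x
      obtain ⟨C, hC⟩ := ((isCompact_closedBall x 1).prod
        (isCompact_Icc (a := (0 : ℝ)) (b := 1))).exists_bound_of_continuousOn hcont.continuousOn
      refine (intervalIntegral.hasFDerivAt_integral_of_dominated_of_fderiv_le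
        (F := fun y t => g (y, t))
        (F' := fun y t => (fderiv ℝ g (y, t)).comp (ContinuousLinearMap.inl ℝ V ℝ))
        (bound := fun _ => C) (Metric.closedBall_mem_nhds x one_pos) ?_ ?_ ?_ ?_ ?_ ?_)
      · exact Eventually.of_forall fun y =>
          (hg.continuous.comp (by fun_prop : Continuous fun t : ℝ => (y, t))).aestronglyMeasurable
      · exact (hg.continuous.comp
          (by fun_prop : Continuous fun t : ℝ => (x, t))).intervalIntegrable _ _
      · exact (hcont.comp (by fun_prop : Continuous fun t : ℝ => (x, t))).aestronglyMeasurable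
      · refine Eventually.of_forall fun t ht y hy => hC (y, t) ⟨hy, ?_⟩
        rw [Set.uIoc_of_le zero_le_one] at ht
        exact ⟨ht.1.le, ht.2⟩
      · exact intervalIntegrable_const
      · exact Eventually.of_forall fun t _ y _ => hpart y t
    rw [Nat.cast_add, Nat.cast_one, contDiff_succ_iff_fderiv_apply]
    refine ⟨fun x => (key x).differentiableAt, by simp, fun y => ?_⟩
    have : (fun x => fderiv ℝ (fun x => ∫ t in (0 : ℝ)..1, g (x, t)) x y) =
        fun x => ∫ t in (0 : ℝ)..1, fderiv ℝ g (x, t) (y, 0) := by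
      funext x
      rw [(key x).fderiv, ContinuousLinearMap.intervalIntegral_apply]
      · simp
      · exact (hcont.comp (by fun_prop : Continuous fun t : ℝ => (x, t))).intervalIntegrable _ _
    rw [this]
    exact ih (g := fun z => fderiv ℝ g z (y, 0))
      ((hg.fderiv_right (m := ∞) (by simp)).clm_apply contDiff_const)

/-- Hadamard's lemma: a smooth function that vanishes on the kernel of a linear form is a smooth
multiple of this form. -/
lemma exists_contDiff_eq_mul_of_ker {F : V → ℝ} (hF : ContDiff ℝ ∞ F) (l : V →L[ℝ] ℝ)
    (hl : l ≠ 0) (h0 : ∀ x, l x = 0 → F x = 0) :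
    ∃ G : V → ℝ, ContDiff ℝ ∞ G ∧ ∀ x, F x = l x * G x := by
  obtain ⟨v, hv⟩ : ∃ v, l v = 1 := by
    obtain ⟨u, hu⟩ : ∃ u, l u ≠ 0 := by
      by_contra! h
      exact hl (ContinuousLinearMap.ext h)
    exact ⟨(l u)⁻¹ • u, by simp [hu]⟩
  have hline : ContDiff ℝ ∞ fun z : V × ℝ => z.1 - l z.1 • v + (z.2 * l z.1) • v := by fun_prop
  refine ⟨fun x => ∫ t in (0 : ℝ)..1, fderiv ℝ F (x - l x • v + (t * l x) • v) v,
    contDiff_integral_unitInterval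
      (g := fun z : V × ℝ => fderiv ℝ F (z.1 - l z.1 • v + (z.2 * l z.1) • v) v)
      (((hF.fderiv_right (m := ∞) (by simp)).comp hline).clm_apply contDiff_const), fun x => ?_⟩
  have hd : ∀ t : ℝ, HasDerivAt (fun t : ℝ => F (x - l x • v + (t * l x) • v))
      (l x * fderiv ℝ F (x - l x • v + (t * l x) • v) v) t := by
    intro t
    have h1 : HasDerivAt (fun t : ℝ => x - l x • v + (t * l x) • v) (l x • v) t := by
      have := (((hasDerivAt_id t).mul_const (l x)).smul_const v).const_add (x - l x • v)
      simpa using this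
    have h2 := ((hF.differentiable (by simp)) (x - l x • v + (t * l x) • v)).hasFDerivAt
    have h3 := h2.comp_hasDerivAt t h1
    rw [map_smul, smul_eq_mul] at h3
    exact h3
  have hc : Continuous fun t : ℝ => l x * fderiv ℝ F (x - l x • v + (t * l x) • v) v := by
    have := hF.continuous_fderiv (by simp)
    fun_prop
  have := intervalIntegral.integral_eq_sub_of_hasDerivAt (fun t _ => hd t)
    (hc.intervalIntegrable 0 1)
  rw [intervalIntegral.integral_const_mul] at this
  rw [this]
  simp [h0 (x - l x • v) (by simp [hv])]

/-- A smooth function that vanishes on the kernels of finitely many pairwise non-proportional linear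
forms is a smooth multiple of their product. -/
lemma exists_contDiff_eq_prod_mul {κ : Type*} (S : Finset κ) (l : κ → V →L[ℝ] ℝ)
    (hl : ∀ i ∈ S, l i ≠ 0)
    (hne : ∀ i ∈ S, ∀ k ∈ S, i ≠ k → ∃ y, l i y = 0 ∧ l k y ≠ 0)
    {F : V → ℝ} (hF : ContDiff ℝ ∞ F) (h0 : ∀ i ∈ S, ∀ x, l i x = 0 → F x = 0) :
    ∃ G : V → ℝ, ContDiff ℝ ∞ G ∧ ∀ x, F x = (∏ i ∈ S, l i x) * G x := by
  classical
  induction S using Finset.induction_on generalizing F with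
  | empty => exact ⟨F, hF, by simp⟩
  | insert k S hk ih =>
    obtain ⟨G, hG, hFG⟩ := exists_contDiff_eq_mul_of_ker hF (l k) (hl k (by simp))
      (h0 k (by simp))
    obtain ⟨H, hH, hGH⟩ := ih (fun i hi => hl i (by simp [hi]))
      (fun i hi m hm => hne i (by simp [hi]) m (by simp [hm])) hG (by
        intro i hi x hx
        have hik : i ≠ k := fun h => hk (h ▸ hi)
        obtain ⟨y, hy, hky⟩ := hne i (by simp [hi]) k (by simp) hik
        -- On the line `x + t y` the form `l k` vanishes at most once, so `G` is zero near `x`.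
        have hev : ∀ᶠ t : ℝ in 𝓝[≠] 0, G (x + t • y) = 0 := by
          have h1 : ∀ᶠ t : ℝ in 𝓝[≠] 0, l k (x + t • y) ≠ 0 := by
            by_cases hx0 : l k x = 0
            · filter_upwards [self_mem_nhdsWithin] with t ht
              simpa [hx0, hky] using ht
            · have hc : Continuous fun t : ℝ => l k (x + t • y) := by fun_prop
              exact (hc.tendsto' 0 (l k x) (by simp)).eventually_ne hx0 |>.filter_mono
                nhdsWithin_le_nhds
          filter_upwards [h1] with t ht
          have h2 := hFG (x + t • y)
          rw [h0 i (by simp [hi]) _ (by simp [hx, hy])] at h2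
          exact (mul_eq_zero.mp h2.symm).resolve_left ht
        have hc : Continuous fun t : ℝ => G (x + t • y) :=
          hG.continuous.comp (by fun_prop)
        have h3 : Tendsto (fun t : ℝ => G (x + t • y)) (𝓝[≠] 0) (𝓝 (G x)) :=
          (hc.tendsto' 0 (G x) (by simp)).mono_left nhdsWithin_le_nhds
        exact tendsto_nhds_unique (h3.congr' hev) tendsto_const_nhds)
    exact ⟨H, hH, fun x => by rw [hFG, hGH, Finset.prod_insert hk, mul_assoc]⟩

end Division

variable {ι E I : Type*} [NormedAddCommGroup E] [InnerProductSpace ℝ E] {R : RootPairing ι ℝ E E}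

/-! ### Euclidean root systems -/

lemma inner_root_pos (R : RootPairing ι ℝ E E) (i : ι) : (0 : ℝ) < inner ℝ (R.root i) (R.root i) :=
  real_inner_self_pos.mpr (R.ne_zero i)

lemma coroot_scale_pos (R : RootPairing ι ℝ E E) (i : ι) :
    (0 : ℝ) < 2 / inner ℝ (R.root i) (R.root i) :=
  div_pos two_pos (inner_root_pos R i)

namespace IsEuclidean

variable (hR : IsEuclidean R)
include hR

lemma inner_coroot (x : E) (i : ι) :
    inner ℝ x (R.coroot i) = 2 / inner ℝ (R.root i) (R.root i) * inner ℝ x (R.root i) := by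
  rw [hR.2 i, real_inner_smul_right]

lemma inner_root_coroot_self (i : ι) : inner ℝ (R.root i) (R.coroot i) = (2 : ℝ) := by
  rw [← hR.1, R.root_coroot_two]

lemma reflection_apply (i : ι) (x : E) :
    R.reflection i x = x - (inner ℝ x (R.coroot i) : ℝ) • R.root i := by
  rw [← hR.1]; exact R.reflection_apply i x

lemma reflection_apply_coroot (i : ι) (x : E) :
    R.reflection i x = x - (inner ℝ x (R.root i) : ℝ) • R.coroot i := by
  rw [hR.reflection_apply, hR.inner_coroot, hR.2 i, smul_smul, mul_comm]

lemma coroot_reflectionPerm (i j : ι) :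
    R.coroot (R.reflectionPerm i j) = R.reflection i (R.coroot j) := by
  rw [hR.reflection_apply_coroot, ← R.reflectionPerm_coroot, hR.1, real_inner_comm]

lemma inner_reflection_reflection (i : ι) (x y : E) :
    (inner ℝ (R.reflection i x) (R.reflection i y) : ℝ) = inner ℝ x y := by
  rw [hR.reflection_apply, hR.reflection_apply_coroot i y, inner_sub_left, inner_sub_right,
    inner_sub_right, real_inner_smul_left, real_inner_smul_right, real_inner_smul_left,
    real_inner_smul_right, hR.inner_root_coroot_self, real_inner_comm y (R.root i)]
  ring

lemma inner_reflection_left (i : ι) (x y : E) :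
    (inner ℝ (R.reflection i x) y : ℝ) = inner ℝ x (R.reflection i y) := by
  rw [← hR.inner_reflection_reflection i x, R.reflection_same]

lemma norm_reflection (i : ι) (x : E) : ‖R.reflection i x‖ = ‖x‖ := by
  have := hR.inner_reflection_reflection i x x
  rw [real_inner_self_eq_norm_sq, real_inner_self_eq_norm_sq] at this
  exact (pow_left_inj₀ (norm_nonneg _) (norm_nonneg _) two_ne_zero).mp this

lemma exists_int_inner [R.IsCrystallographic] (i j : ι) :
    ∃ n : ℤ, inner ℝ (R.root i) (R.coroot j) = (n : ℝ) := by
  obtain ⟨n, hn⟩ := R.exists_value (S := ℤ) i j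
  exact ⟨n, by rw [← hR.1]; simpa using hn.symm⟩

lemma coroot_of_root_eq_smul {i j : ι} {c : ℝ} (h : R.root j = c • R.root i) :
    c ≠ 0 ∧ R.coroot j = c⁻¹ • R.coroot i := by
  have hc : c ≠ 0 := by
    rintro rfl
    exact R.ne_zero j (by simpa using h)
  refine ⟨hc, ?_⟩
  rw [hR.2, hR.2, h, real_inner_smul_left, real_inner_smul_right, smul_smul, smul_smul]
  congr 1
  have := (inner_root_pos R i).ne'
  field_simp

/-- A positive factor `c` between proportional roots is `1/2`, `1` or `2`, since `2 c` and `2 / c` are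
integers. -/
lemma smul_cases [R.IsCrystallographic] {i j : ι} {c : ℝ} (hc : 0 < c)
    (h : R.root j = c • R.root i) : c = 1 / 2 ∨ c = 1 ∨ c = 2 := by
  obtain ⟨m, hm⟩ := hR.exists_int_inner j i
  obtain ⟨n, hn⟩ := hR.exists_int_inner i j
  rw [h, real_inner_smul_left, hR.inner_root_coroot_self] at hm
  rw [(hR.coroot_of_root_eq_smul h).2, real_inner_smul_right, hR.inner_root_coroot_self] at hn
  have hmn : (m : ℝ) * n = 4 := by
    rw [← hm, ← hn]; field_simp; norm_num
  have hmn' : m * n = 4 := by exact_mod_cast hmn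
  have hm0 : 0 < m := by
    have : (0 : ℝ) < m := by rw [← hm]; positivity
    exact_mod_cast this
  have hm4 : m ≤ 4 := Int.le_of_dvd (by norm_num) ⟨n, hmn'.symm⟩
  interval_cases m
  · left; push_cast at hm; linarith
  · right; left; push_cast at hm; linarith
  · omega
  · right; right; push_cast at hm; linarith

end IsEuclidean

/-! ### Positive roots and parabolic subsystems -/

namespace SimpleRoots

variable (b : SimpleRoots R I)

lemma repr_root_idx [DecidableEq I] (k l : I) :
    b.basis.repr (R.root (b.idx k)) l = if k = l then 1 else 0 := by
  rw [← b.basis_apply, b.basis.repr_self, Finsupp.single_apply]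

lemma exists_nat_repr {x : E} (hx : x ∈ AddSubmonoid.closure (Set.range b.basis)) (k : I) :
    ∃ n : ℕ, b.basis.repr x k = n := by
  classical
  induction hx using AddSubmonoid.closure_induction with
  | mem x hx =>
    obtain ⟨l, rfl⟩ := hx
    exact ⟨if l = k then 1 else 0, by simp [Finsupp.single_apply]⟩
  | zero => exact ⟨0, by simp⟩
  | add x y _ _ hx hy =>
    obtain ⟨m, hm⟩ := hx
    obtain ⟨n, hn⟩ := hy
    exact ⟨m + n, by simp [hm, hn]⟩

variable {b}

lemma IsPos.exists_nat_repr {i : ι} (h : b.IsPos i) (k : I) :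
    ∃ n : ℕ, b.basis.repr (R.root i) k = n :=
  b.exists_nat_repr h k

lemma IsPos.repr_nonneg {i : ι} (h : b.IsPos i) (k : I) : 0 ≤ b.basis.repr (R.root i) k := by
  obtain ⟨n, hn⟩ := h.exists_nat_repr k
  simp [hn]

lemma isPos_of_repr_pos {i : ι} {k : I} (h : 0 < b.basis.repr (R.root i) k) : b.IsPos i := by
  refine (b.pos_or_neg i).resolve_right fun hneg => ?_
  obtain ⟨n, hn⟩ := b.exists_nat_repr hneg k
  rw [map_neg, Finsupp.neg_apply] at hn
  have : (0 : ℝ) ≤ n := n.cast_nonneg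
  linarith

lemma IsPos.exists_repr_pos {i : ι} (h : b.IsPos i) : ∃ k, 0 < b.basis.repr (R.root i) k := by
  by_contra! hk
  have : b.basis.repr (R.root i) = 0 := by
    ext k
    exact le_antisymm (hk k) (h.repr_nonneg k)
  exact R.ne_zero i (b.basis.repr.map_eq_zero_iff.mp this)

lemma isPos_of_root_eq_smul {i j : ι} {c : ℝ} (hc : 0 < c) (h : R.root j = c • R.root i)
    (hi : b.IsPos i) : b.IsPos j := by
  obtain ⟨k, hk⟩ := hi.exists_repr_pos
  exact isPos_of_repr_pos (k := k) (by simpa [h, hk] using hc)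

lemma isPosIndiv_iff {i : ι} :
    b.IsPosIndiv i ↔ b.IsPos i ∧ (1 / 2 : ℝ) • R.root i ∉ Set.range R.root := by
  refine and_congr_right fun hi => not_congr ⟨fun ⟨j, _, hj⟩ => ⟨j, hj⟩, fun ⟨j, hj⟩ => ⟨j, ?_, hj⟩⟩
  exact isPos_of_root_eq_smul (by norm_num) hj hi

variable (b)

lemma isPos_idx (k : I) : b.IsPos (b.idx k) :=
  AddSubmonoid.subset_closure ⟨k, b.basis_apply k⟩

lemma isPosIndiv_idx (k : I) : b.IsPosIndiv (b.idx k) := by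
  classical
  refine ⟨b.isPos_idx k, ?_⟩
  rintro ⟨j, hj, h⟩
  obtain ⟨n, hn⟩ := hj.exists_nat_repr k
  rw [h, map_smul, Finsupp.smul_apply, b.repr_root_idx, if_pos rfl, smul_eq_mul, mul_one] at hn
  have h2 : (1 : ℝ) = 2 * n := by linarith
  have h3 : 1 = 2 * n := by exact_mod_cast h2
  omega

section FiniteDimensional

variable [FiniteDimensional ℝ E]

lemma inner_coweight_right (x : E) (k : I) :
    (inner ℝ x (b.coweight k) : ℝ) = b.basis.repr x k := by
  rw [real_inner_comm, SimpleRoots.coweight, InnerProductSpace.toDual_symm_apply]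
  simp

variable {b}

lemma mem_iff {J : Finset I} {i : ι} :
    b.Mem J i ↔ ∀ k, k ∉ J → b.basis.repr (R.root i) k = 0 := by
  simp only [SimpleRoots.Mem, inner_coweight_right]

lemma mem_idx {J : Finset I} {k : I} (hk : k ∈ J) : b.Mem J (b.idx k) := by
  classical
  rw [mem_iff]
  intro l hl
  rw [b.repr_root_idx, if_neg]
  rintro rfl
  exact hl hk

lemma Mem.mono {J K : Finset I} (h : K ⊆ J) {i : ι} (hi : b.Mem K i) : b.Mem J i :=
  fun k hk => hi k fun h' => hk (h h')

lemma Mem.smul {J : Finset I} {i j : ι} {c : ℝ} (h : R.root j = c • R.root i) (hi : b.Mem J i) :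
    b.Mem J j := by
  rw [mem_iff] at hi ⊢
  intro k hk
  simp [h, hi k hk]

variable [Fintype I]

omit [FiniteDimensional ℝ E] in
lemma inner_root_eq_sum (b : SimpleRoots R I) (x : E) (i : ι) :
    (inner ℝ x (R.root i) : ℝ) =
      ∑ k, b.basis.repr (R.root i) k * inner ℝ x (R.root (b.idx k)) := by
  conv_lhs => rw [← b.basis.sum_repr (R.root i)]
  simp only [inner_sum, real_inner_smul_right, b.basis_apply]

lemma Mem.inner_eq_sum {J : Finset I} {i : ι} (hi : b.Mem J i) (x : E) :
    (inner ℝ x (R.root i) : ℝ) =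
      ∑ k ∈ J, b.basis.repr (R.root i) k * inner ℝ x (R.root (b.idx k)) := by
  rw [b.inner_root_eq_sum]
  symm
  refine Finset.sum_subset (Finset.subset_univ _) fun k _ hk => ?_
  rw [mem_iff.mp hi k hk, zero_mul]

/-- The sum of the fundamental coweights: it pairs to `1` with all simple roots. -/
def heightVec (b : SimpleRoots R I) : E := ∑ k, b.coweight k

lemma inner_heightVec (x : E) : (inner ℝ x b.heightVec : ℝ) = ∑ k, b.basis.repr x k := by
  simp only [heightVec, inner_sum, inner_coweight_right]

lemma IsPos.inner_heightVec_pos {i : ι} (h : b.IsPos i) :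
    (0 : ℝ) < inner ℝ (R.root i) b.heightVec := by
  rw [inner_heightVec]
  obtain ⟨k, hk⟩ := h.exists_repr_pos
  exact Finset.sum_pos' (fun k _ => h.repr_nonneg k) ⟨k, Finset.mem_univ _, hk⟩

/-- A positive root of `Φ_J` has positive pairing with a vector that is positive on the simple
roots of `J`. -/
lemma Mem.inner_pos {J : Finset I} {i : ι} (hi : b.Mem J i) (hpos : b.IsPos i) {x : E}
    (hx : ∀ k ∈ J, (0 : ℝ) < inner ℝ x (R.root (b.idx k))) : (0 : ℝ) < inner ℝ x (R.root i) := by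
  rw [hi.inner_eq_sum]
  obtain ⟨k, hk⟩ := hpos.exists_repr_pos
  refine Finset.sum_pos' (fun l hl => mul_nonneg (hpos.repr_nonneg l) (hx l hl).le)
    ⟨k, ?_, ?_⟩
  · by_contra hkJ
    exact hk.ne' (mem_iff.mp hi k hkJ)
  · refine mul_pos hk (hx k ?_)
    by_contra hkJ
    exact hk.ne' (mem_iff.mp hi k hkJ)

end FiniteDimensional

end SimpleRoots

section Reflections

variable [FiniteDimensional ℝ E] {b : SimpleRoots R I} {J : Finset I} (hR : IsEuclidean R)
include hR

namespace SimpleRoots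

lemma Mem.reflectionPerm {i j : ι} (hj : b.Mem J j) (hi : b.Mem J i) :
    b.Mem J (R.reflectionPerm j i) := by
  rw [mem_iff] at hi hj ⊢
  intro k hk
  rw [R.root_reflectionPerm, hR.reflection_apply]
  simp [hi k hk, hj k hk]

omit [FiniteDimensional ℝ E] hR in
lemma IsPos.exists_repr_pos_ne {i : ι} (hi : b.IsPos i) {j : I}
    (h : ∀ c : ℝ, R.root i ≠ c • R.root (b.idx j)) :
    ∃ k, k ≠ j ∧ 0 < b.basis.repr (R.root i) k := by
  classical
  by_contra! hk
  refine h (b.basis.repr (R.root i) j) (b.basis.repr.injective ?_)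
  ext k
  rw [map_smul, Finsupp.smul_apply, b.repr_root_idx]
  split_ifs with hjk
  · simp [hjk]
  · simpa using le_antisymm (hk k (Ne.symm hjk)) (hi.repr_nonneg k)

omit [FiniteDimensional ℝ E] in
lemma repr_reflectionPerm_of_ne {j k : I} (hkj : k ≠ j) (i : ι) :
    b.basis.repr (R.root (R.reflectionPerm (b.idx j) i)) k = b.basis.repr (R.root i) k := by
  classical
  rw [R.root_reflectionPerm, hR.reflection_apply]
  simp [b.repr_root_idx, hkj.symm]

omit [FiniteDimensional ℝ E] in
/-- The simple reflection in `α_j` permutes the indivisible positive roots other than `α_j`. -/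
lemma IsPosIndiv.reflectionPerm [R.IsCrystallographic] {i : ι} (hi : b.IsPosIndiv i) {j : I}
    (hij : i ≠ b.idx j) :
    b.IsPosIndiv (R.reflectionPerm (b.idx j) i) ∧ R.reflectionPerm (b.idx j) i ≠ b.idx j := by
  classical
  have hi' := isPosIndiv_iff.mp hi
  obtain ⟨k, hkj, hk⟩ : ∃ k, k ≠ j ∧ 0 < b.basis.repr (R.root i) k := by
    refine hi.1.exists_repr_pos_ne fun c hroot => ?_
    have hcpos : 0 < c := by
      obtain ⟨k, hk⟩ := hi.1.exists_repr_pos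
      rw [hroot, map_smul, Finsupp.smul_apply, smul_eq_mul] at hk
      exact pos_of_mul_pos_left hk ((b.isPos_idx j).repr_nonneg k)
    rcases hR.smul_cases hcpos hroot with rfl | rfl | rfl
    · exact (isPosIndiv_iff.mp (b.isPosIndiv_idx j)).2 ⟨i, hroot⟩
    · exact hij (R.root.injective (by rw [hroot, one_smul]))
    · exact hi'.2 ⟨b.idx j, by rw [hroot, smul_smul]; norm_num⟩
  have hrepr := repr_reflectionPerm_of_ne (b := b) hR hkj i
  refine ⟨isPosIndiv_iff.mpr ⟨isPos_of_repr_pos (k := k) (hrepr ▸ hk), ?_⟩, ?_⟩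
  · rintro ⟨l, hl⟩
    refine hi'.2 ⟨R.reflectionPerm (b.idx j) l, ?_⟩
    rw [R.root_reflectionPerm, hl, map_smul, R.root_reflectionPerm, R.reflection_same]
  · intro h
    rw [h, b.repr_root_idx, if_neg hkj.symm] at hrepr
    exact hk.ne hrepr

/-- A function which is odd under the simple reflections of `W_J` vanishes on the hyperplanes
orthogonal to the positive roots of `Φ_J`: every such root is moved to a multiple of a simple root
by simple reflections that lower its height. -/
lemma eq_zero_of_odd [Fintype ι] [Fintype I] [R.IsCrystallographic] {f : E → ℝ}
    (hf : ∀ j ∈ J, ∀ x, f (R.reflection (b.idx j) x) = -f x) {i : ι} (hi : b.IsPos i)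
    (hiJ : b.Mem J i) {x : E} (hx : inner ℝ x (R.root i) = (0 : ℝ)) : f x = 0 := by
  classical
  by_contra hfx
  obtain ⟨i, hmem, hmin⟩ := Finset.exists_min_image
    (Finset.univ.filter fun i => b.IsPos i ∧ b.Mem J i ∧
      ∃ x, inner ℝ x (R.root i) = (0 : ℝ) ∧ f x ≠ 0)
    (fun i => (inner ℝ (R.root i) b.heightVec : ℝ)) ⟨i, by simp [hi, hiJ]; exact ⟨x, hx, hfx⟩⟩
  simp only [Finset.mem_filter, Finset.mem_univ, true_and] at hmem hmin
  obtain ⟨hi, hiJ, x, hx, hfx⟩ := hmem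
  obtain ⟨j, hj, hpos⟩ : ∃ j ∈ J, (0 : ℝ) < inner ℝ (R.root i) (R.root (b.idx j)) := by
    by_contra! h
    have h1 := inner_root_pos R i
    rw [hiJ.inner_eq_sum] at h1
    exact h1.not_ge (Finset.sum_nonpos fun k hk =>
      mul_nonpos_of_nonneg_of_nonpos (hi.repr_nonneg k) (h k hk))
  by_cases hprop : ∃ c : ℝ, R.root i = c • R.root (b.idx j)
  · obtain ⟨c, hc⟩ := hprop
    rw [hc, real_inner_smul_right] at hx
    have hxj := (mul_eq_zero.mp hx).resolve_left (hR.coroot_of_root_eq_smul hc).1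
    have h1 := hf j hj x
    rw [hR.reflection_apply_coroot, hxj, zero_smul, sub_zero] at h1
    exact hfx (by linarith)
  · have hposr : b.IsPos (R.reflectionPerm (b.idx j) i) := by
      obtain ⟨k, hkj, hk⟩ := hi.exists_repr_pos_ne (not_exists.mp hprop)
      exact isPos_of_repr_pos (k := k) (by rwa [repr_reflectionPerm_of_ne hR hkj])
    have h1 := hmin (R.reflectionPerm (b.idx j) i) ⟨hposr, Mem.reflectionPerm hR (mem_idx hj) hiJ,
      R.reflection (b.idx j) x, by
        rw [R.root_reflectionPerm, hR.inner_reflection_reflection, hx], by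
        rw [hf j hj]; exact neg_ne_zero.mpr hfx⟩
    rw [R.root_reflectionPerm, hR.reflection_apply, inner_sub_left, real_inner_smul_left,
      hR.inner_coroot] at h1
    have h2 := mul_pos (mul_pos (coroot_scale_pos R (b.idx j)) hpos)
      (b.isPos_idx j).inner_heightVec_pos
    linarith

end SimpleRoots

omit [FiniteDimensional ℝ E] in
/-- Distinct indivisible positive roots are not proportional. -/
lemma exists_inner_eq_zero_of_ne [R.IsCrystallographic] {i k : ι} (hi : b.IsPosIndiv i)
    (hk : b.IsPosIndiv k) (hik : i ≠ k) :
    ∃ y : E, inner ℝ (R.coroot i) y = (0 : ℝ) ∧ inner ℝ (R.coroot k) y ≠ (0 : ℝ) := by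
  by_contra! h
  have h1 := inner_root_pos R i
  have hi' := SimpleRoots.isPosIndiv_iff.mp hi
  have hk' := SimpleRoots.isPosIndiv_iff.mp hk
  -- The component of `α_k` orthogonal to `α_i` is orthogonal to `α_k`, hence zero.
  set c : ℝ := inner ℝ (R.root i) (R.root k) / inner ℝ (R.root i) (R.root i) with hc
  have h0 : (inner ℝ (R.root i) (R.root k - c • R.root i) : ℝ) = 0 := by
    rw [inner_sub_right, real_inner_smul_right, hc]
    field_simp
    ring
  have h2 := h (R.root k - c • R.root i) (by rw [hR.2, real_inner_smul_left, h0, mul_zero])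
  rw [hR.2, real_inner_smul_left] at h2
  have h3 := (mul_eq_zero.mp h2).resolve_left (coroot_scale_pos R k).ne'
  have h4 : (inner ℝ (R.root k - c • R.root i) (R.root k - c • R.root i) : ℝ) = 0 := by
    rw [inner_sub_left, h3, real_inner_smul_left, h0]; simp
  have h5 : R.root k = c • R.root i := sub_eq_zero.mp (inner_self_eq_zero.mp h4)
  have hcpos : 0 < c := by
    obtain ⟨l, hl⟩ := hk.1.exists_repr_pos
    rw [h5, map_smul, Finsupp.smul_apply, smul_eq_mul] at hl
    exact pos_of_mul_pos_left hl (hi.1.repr_nonneg l)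
  rcases hR.smul_cases hcpos h5 with h6 | h6 | h6
  · exact hi'.2 ⟨k, by rw [h5, h6]⟩
  · exact hik (R.root.injective (by rw [h5, h6, one_smul]))
  · exact hk'.2 ⟨i, by rw [h5, h6, smul_smul]; norm_num⟩

end Reflections

/-! ### Shift operators -/

/-- The value at `θ` of an exponential sum: the algebra homomorphism that sends the basis vector of
the group algebra at `v` to `e^{⟨θ, v⟩}`. -/
def evalExp (θ : E) : AddMonoidAlgebra ℝ E →ₐ[ℝ] ℝ :=
  AddMonoidAlgebra.lift ℝ ℝ E
    { toFun := fun v => Real.exp (inner ℝ θ v.toAdd)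
      map_one' := by simp
      map_mul' := fun v w => by simp [inner_add_right, Real.exp_add] }

/-- The action of the group algebra on functions by translations: the basis vector at `v` sends `f`
to `f (· + v)`. -/
def shift : AddMonoidAlgebra ℝ E →ₐ[ℝ] Module.End ℝ (E → ℝ) :=
  AddMonoidAlgebra.lift ℝ (Module.End ℝ (E → ℝ)) E
    { toFun := fun v => LinearMap.funLeft ℝ ℝ fun x => x + v.toAdd
      map_one' := by ext; simp [LinearMap.funLeft_apply]
      map_mul' := fun v w => by
        ext f x
        simp only [toAdd_mul, LinearMap.funLeft_apply, Module.End.mul_apply]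
        rw [add_assoc] }

@[simp]
lemma evalExp_single (θ v : E) (a : ℝ) :
    evalExp θ (AddMonoidAlgebra.single v a) = a * Real.exp (inner ℝ θ v) := by
  simp [evalExp]

omit [InnerProductSpace ℝ E] in
@[simp]
lemma shift_single (v : E) (a : ℝ) (f : E → ℝ) (x : E) :
    shift (AddMonoidAlgebra.single v a) f x = a * f (x + v) := by
  simp [shift, LinearMap.funLeft_apply]

omit [InnerProductSpace ℝ E] in
lemma shift_mul_apply (m n : AddMonoidAlgebra ℝ E) (f : E → ℝ) :
    shift (m * n) f = shift m (shift n f) := by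
  rw [map_mul, Module.End.mul_apply]

omit [InnerProductSpace ℝ E] in
lemma tendsto_shift {T : Type*} {l : Filter T} (n : AddMonoidAlgebra ℝ E) {h : T → E → ℝ}
    {h₀ : E → ℝ} (hh : ∀ x, Tendsto (fun t => h t x) l (𝓝 (h₀ x))) (x : E) :
    Tendsto (fun t => shift n (h t) x) l (𝓝 (shift n h₀ x)) := by
  induction n using AddMonoidAlgebra.induction_linear with
  | zero => simpa using tendsto_const_nhds
  | add m n hm hn => simpa using hm.add hn
  | single v a => simpa using (hh (x + v)).const_mul a

lemma shift_exp (n : AddMonoidAlgebra ℝ E) (θ x : E) :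
    shift n (fun x => Real.exp (inner ℝ θ x)) x = evalExp θ n * Real.exp (inner ℝ θ x) := by
  induction n using AddMonoidAlgebra.induction_linear with
  | zero => simp
  | add m n hm hn => simp [hm, hn, add_mul]
  | single v a => simp [inner_add_right, Real.exp_add]; ring

omit [InnerProductSpace ℝ E] in
/-- Translations commute. -/
lemma shift_translate (n : AddMonoidAlgebra ℝ E) (f : E → ℝ) (v x : E) :
    shift n (fun y => f (y + v)) x = shift n f (x + v) := by
  induction n using AddMonoidAlgebra.induction_linear with
  | zero => simp
  | add m n hm hn => simp [hm, hn]
  | single w a => simp [add_right_comm]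

/-! ### Products over the indivisible positive roots -/

section Products

variable [Fintype ι] [FiniteDimensional ℝ E] (b : SimpleRoots R I) (J : Finset I)

open Classical in
/-- The indices of `Φ_J⁺⁺`. -/
def posIndiv : Finset ι := {i | b.IsPosIndiv i ∧ b.Mem J i}

variable {b J}

lemma mem_posIndiv {i : ι} : i ∈ posIndiv b J ↔ b.IsPosIndiv i ∧ b.Mem J i := by
  simp [posIndiv]

lemma posIndiv_mono {K : Finset I} (h : K ⊆ J) : posIndiv b K ⊆ posIndiv b J := fun i hi => by
  rw [mem_posIndiv] at hi ⊢
  exact ⟨hi.1, hi.2.mono h⟩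

lemma idx_mem_posIndiv {j : I} (hj : j ∈ J) : b.idx j ∈ posIndiv b J :=
  mem_posIndiv.mpr ⟨b.isPosIndiv_idx j, SimpleRoots.mem_idx hj⟩

omit [Fintype ι] [FiniteDimensional ℝ E] in
lemma prod_reflectionPerm {M : Type*} [CommMonoid M] {S : Finset ι} {j : ι}
    (hS : ∀ i ∈ S, R.reflectionPerm j i ∈ S) (g : ι → M) :
    ∏ i ∈ S, g (R.reflectionPerm j i) = ∏ i ∈ S, g i :=
  Finset.prod_nbij' (R.reflectionPerm j) (R.reflectionPerm j) hS hS
    (fun i _ => R.reflectionPerm_self j i) (fun i _ => R.reflectionPerm_self j i) fun _ _ => rfl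

variable (b J) in
/-- The product `∏ ⟨x, α^∨⟩` over `Φ_J⁺⁺`. -/
def delta (x : E) : ℝ := ∏ i ∈ posIndiv b J, inner ℝ x (R.coroot i)

lemma delta_smul (t : ℝ) (x : E) : delta b J (t • x) = t ^ (posIndiv b J).card * delta b J x := by
  simp [delta, real_inner_smul_left, Finset.prod_mul_distrib]

variable (hR : IsEuclidean R)
include hR

lemma delta_pos [Fintype I] {x : E} (hx : ∀ k ∈ J, (0 : ℝ) < inner ℝ x (R.root (b.idx k))) :
    0 < delta b J x :=
  Finset.prod_pos fun i hi => by
    rw [mem_posIndiv] at hi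
    rw [hR.inner_coroot]
    exact mul_pos (coroot_scale_pos R i) (hi.2.inner_pos hi.1.1 hx)

lemma delta_heightVec_pos [Fintype I] : 0 < delta b J b.heightVec :=
  delta_pos hR fun k _ => by
    rw [real_inner_comm]
    exact (b.isPos_idx k).inner_heightVec_pos

omit hR in
lemma delta_ne_zero_of_regular {θ : E} (hθ : θ ∈ regular b J) : delta b J θ ≠ 0 :=
  Finset.prod_ne_zero_iff.mpr fun i hi => hθ i (mem_posIndiv.mp hi).2

omit [Fintype ι] in
lemma smul_heightVec_mem_regular [Fintype I] {t : ℝ} (ht : t ≠ 0) :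
    t • b.heightVec ∈ regular b J := by
  intro i _
  rw [real_inner_smul_left]
  refine mul_ne_zero ht ?_
  rw [hR.inner_coroot, real_inner_comm (R.root i) b.heightVec]
  refine mul_ne_zero (coroot_scale_pos R i).ne' ?_
  rcases b.pos_or_neg i with h | h
  · exact (SimpleRoots.IsPos.inner_heightVec_pos (b := b) h).ne'
  · obtain ⟨j, hj⟩ := R.neg_root_mem i
    have : b.IsPos j := by rw [SimpleRoots.IsPos, hj]; exact h
    have h1 := this.inner_heightVec_pos
    rw [hj, inner_neg_left] at h1
    linarith

omit [Fintype ι] in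
lemma neBot_regular [Fintype I] : (𝓝[regular b J] (0 : E)).NeBot := by
  have h : Tendsto (fun t : ℝ => t • b.heightVec) (𝓝[≠] 0) (𝓝[regular b J] 0) := by
    refine tendsto_nhdsWithin_of_tendsto_nhds_of_eventually_within _ ?_ ?_
    · have : Continuous fun t : ℝ => t • b.heightVec := by fun_prop
      exact (this.tendsto' 0 0 (by simp)).mono_left nhdsWithin_le_nhds
    · filter_upwards [self_mem_nhdsWithin] with t ht
      exact smul_heightVec_mem_regular hR ht
  exact h.neBot

variable [R.IsCrystallographic]

lemma reflectionPerm_mem_erase [DecidableEq ι] {j : I} (hj : j ∈ J) {i : ι}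
    (hi : i ∈ (posIndiv b J).erase (b.idx j)) :
    R.reflectionPerm (b.idx j) i ∈ (posIndiv b J).erase (b.idx j) := by
  rw [Finset.mem_erase, mem_posIndiv] at hi ⊢
  have h := SimpleRoots.IsPosIndiv.reflectionPerm hR hi.2.1 hi.1
  exact ⟨h.2, h.1, SimpleRoots.Mem.reflectionPerm hR (SimpleRoots.mem_idx hj) hi.2.2⟩

lemma reflectionPerm_mem_sdiff [DecidableEq ι] {K : Finset I} (hK : K ⊆ J) {j : I} (hj : j ∈ K)
    {i : ι} (hi : i ∈ posIndiv b J \ posIndiv b K) :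
    R.reflectionPerm (b.idx j) i ∈ posIndiv b J \ posIndiv b K := by
  have hij : i ≠ b.idx j := by
    rintro rfl
    exact (Finset.mem_sdiff.mp hi).2 (idx_mem_posIndiv hj)
  simp only [Finset.mem_sdiff, mem_posIndiv, not_and] at hi ⊢
  have h := SimpleRoots.IsPosIndiv.reflectionPerm hR hi.1.1 hij
  refine ⟨⟨h.1, SimpleRoots.Mem.reflectionPerm hR (SimpleRoots.mem_idx (hK hj)) hi.1.2⟩,
    fun _ hmem => hi.2 hi.1.1 ?_⟩
  have := SimpleRoots.Mem.reflectionPerm hR (SimpleRoots.mem_idx hj) hmem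
  rwa [R.reflectionPerm_self] at this

/-- The product of the values of an odd function at the coroots of `Φ_J⁺⁺` is odd under the simple
reflections of `W_J`. -/
lemma prod_odd_reflection {φ : ℝ → ℝ} (hφ : ∀ u, φ (-u) = -φ u) {j : I} (hj : j ∈ J) (x : E) :
    ∏ i ∈ posIndiv b J, φ (inner ℝ (R.reflection (b.idx j) x) (R.coroot i)) =
      -∏ i ∈ posIndiv b J, φ (inner ℝ x (R.coroot i)) := by
  classical
  rw [← Finset.mul_prod_erase _ _ (idx_mem_posIndiv hj),
    ← Finset.mul_prod_erase _ (fun i => φ (inner ℝ x (R.coroot i))) (idx_mem_posIndiv hj),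
    ← prod_reflectionPerm (fun i => reflectionPerm_mem_erase hR hj)
      (fun i => φ (inner ℝ x (R.coroot i)))]
  have h0 : R.reflection (b.idx j) (R.coroot (b.idx j)) = -R.coroot (b.idx j) := by
    rw [hR.2, map_smul, R.reflection_apply_self, smul_neg]
  simp only [hR.coroot_reflectionPerm, hR.inner_reflection_left, h0, inner_neg_right, hφ]
  ring

lemma delta_reflection {j : I} (hj : j ∈ J) (x : E) :
    delta b J (R.reflection (b.idx j) x) = -delta b J x :=
  prod_odd_reflection hR (φ := id) (fun _ => rfl) hj x

end Products

/-! ### The parabolic subgroups and their alternating sums -/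

section Alternating

/-- The sign of an element of the Weyl group. -/
def sgn (w : E ≃ₗ[ℝ] E) : ℝ := (LinearEquiv.det w : ℝˣ)

lemma sgn_mul (v w : E ≃ₗ[ℝ] E) : sgn (v * w) = sgn v * sgn w := by
  simp [sgn]

variable [FiniteDimensional ℝ E] {b : SimpleRoots R I} {J : Finset I}

lemma sgn_reflection (hR : IsEuclidean R) (i : ι) : sgn (R.reflection i) = -1 := by
  have h : ((ℝ ∙ R.root i)ᗮ).reflection.toLinearMap = (R.reflection i : E →ₗ[ℝ] E) := by
    ext x
    change ((ℝ ∙ R.root i)ᗮ).reflection x = R.reflection i x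
    rw [hR.reflection_apply, hR.inner_coroot]
    rw [Submodule.reflection_orthogonal_apply, Submodule.reflection_singleton_apply,
      real_inner_self_eq_norm_sq, real_inner_comm x]
    simp only [RCLike.ofReal_real_eq_id, id_eq]
    module
  rw [sgn, LinearEquiv.coe_det, ← h, Submodule.det_reflection, Submodule.orthogonal_orthogonal,
    finrank_span_singleton (R.ne_zero i), pow_one]

omit [FiniteDimensional ℝ E] in
lemma weyl_induction {p : (E ≃ₗ[ℝ] E) → Prop} (one : p 1)
    (refl_mul : ∀ j ∈ J, ∀ w, p w → p (R.reflection (b.idx j) * w)) {w : E ≃ₗ[ℝ] E}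
    (hw : w ∈ b.weyl J) : p w := by
  induction hw using Subgroup.closure_induction_left with
  | one => exact one
  | mul_left x hx y _ hy =>
    obtain ⟨j, hj, rfl⟩ := hx
    exact refl_mul j hj y hy
  | inv_mul_cancel x hx y _ hy =>
    obtain ⟨j, hj, rfl⟩ := hx
    rw [R.reflection_inv]
    exact refl_mul j hj y hy

omit [FiniteDimensional ℝ E] in
lemma inner_weyl (hR : IsEuclidean R) {w : E ≃ₗ[ℝ] E} (hw : w ∈ b.weyl J) (x y : E) :
    (inner ℝ (w x) (w y) : ℝ) = inner ℝ x y := by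
  refine weyl_induction (p := fun w => (inner ℝ (w x) (w y) : ℝ) = inner ℝ x y) rfl
    (fun j _ w ih => ?_) hw
  simp only [LinearEquiv.mul_apply]
  rw [hR.inner_reflection_reflection, ih]

lemma sgn_mul_self (hR : IsEuclidean R) {w : E ≃ₗ[ℝ] E} (hw : w ∈ b.weyl J) :
    sgn w * sgn w = 1 := by
  refine weyl_induction (p := fun w => sgn w * sgn w = 1) (by simp [sgn]) (fun j _ w ih => ?_) hw
  rw [sgn_mul, sgn_reflection hR]
  linear_combination ih

lemma sgn_inv (hR : IsEuclidean R) {w : E ≃ₗ[ℝ] E} (hw : w ∈ b.weyl J) : sgn w⁻¹ = sgn w := by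
  have h1 : sgn w⁻¹ * sgn w = 1 := by rw [← sgn_mul]; simp [sgn]
  have h2 := sgn_mul_self hR hw
  linear_combination sgn w * h1 - sgn w⁻¹ * h2

lemma odd_weyl (hR : IsEuclidean R) {f : E → ℝ}
    (hf : ∀ j ∈ J, ∀ x, f (R.reflection (b.idx j) x) = -f x) {w : E ≃ₗ[ℝ] E} (hw : w ∈ b.weyl J)
    (x : E) : f (w x) = sgn w * f x := by
  refine weyl_induction (p := fun w => f (w x) = sgn w * f x) (by simp [sgn])
    (fun j hj w ih => ?_) hw
  rw [LinearEquiv.mul_apply, hf j hj, ih, sgn_mul, sgn_reflection hR]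
  ring

omit [FiniteDimensional ℝ E] in
lemma even_weyl {f : E → ℝ} (hf : ∀ j ∈ J, ∀ x, f (R.reflection (b.idx j) x) = f x)
    {w : E ≃ₗ[ℝ] E} (hw : w ∈ b.weyl J) (x : E) : f (w x) = f x := by
  refine weyl_induction (p := fun w => f (w x) = f x) rfl (fun j hj w ih => ?_) hw
  rw [LinearEquiv.mul_apply, hf j hj, ih]

variable [Fintype ι]

instance weylFintype (b : SimpleRoots R I) (J : Finset I) : Fintype (b.weyl J) :=
  @Fintype.ofFinite _ (b.weyl_finite J)

/-- The alternating sum `∑_{w ∈ W_J} ε(w) e^{⟨w θ, x⟩}`. -/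
def altSum (b : SimpleRoots R I) (J : Finset I) (θ x : E) : ℝ :=
  ∑ w : b.weyl J, sgn w.1 * Real.exp (inner ℝ (w.1 θ) x)

omit [FiniteDimensional ℝ E] in
lemma shift_altSum (n : AddMonoidAlgebra ℝ E) (θ x : E) :
    shift n (altSum b J θ) x =
      ∑ w : b.weyl J, sgn w.1 * (evalExp (w.1 θ) n * Real.exp (inner ℝ (w.1 θ) x)) := by
  have h : altSum b J θ = ∑ w : b.weyl J, sgn w.1 • fun x => Real.exp (inner ℝ (w.1 θ) x) := by
    ext x
    simp [altSum, Finset.sum_apply]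
  rw [h, map_sum, Finset.sum_apply]
  refine Finset.sum_congr rfl fun w _ => ?_
  rw [map_smul, Pi.smul_apply, shift_exp, smul_eq_mul]

omit [FiniteDimensional ℝ E] in
lemma altSum_smul_left (t : ℝ) (θ x : E) :
    altSum b J (t • θ) x = altSum b J θ (t • x) := by
  simp [altSum, real_inner_smul_left, real_inner_smul_right]

lemma contDiff_altSum : ContDiff ℝ ⊤ fun z : E × E => altSum b J z.1 z.2 := by
  unfold altSum
  refine ContDiff.sum fun w _ => contDiff_const.mul (Real.contDiff_exp.comp ?_)
  exact ContDiff.inner ℝ ((w.1.toContinuousLinearEquiv.contDiff).comp contDiff_fst) contDiff_snd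

variable (hR : IsEuclidean R)
include hR

lemma altSum_comm (θ x : E) : altSum b J θ x = altSum b J x θ := by
  refine Fintype.sum_equiv (Equiv.inv _) _ _ fun w => ?_
  rw [Equiv.inv_apply, Subgroup.coe_inv, sgn_inv hR w.2,
    ← inner_weyl hR (inv_mem w.2) (w.1 θ) x, real_inner_comm]
  congr 4
  exact w.1.symm_apply_apply θ

lemma altSum_reflection_left {j : I} (hj : j ∈ J) (θ x : E) :
    altSum b J (R.reflection (b.idx j) θ) x = -altSum b J θ x := by
  have hmem : R.reflection (b.idx j) ∈ b.weyl J := Subgroup.subset_closure ⟨j, hj, rfl⟩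
  rw [altSum, altSum, ← Finset.sum_neg_distrib]
  refine Fintype.sum_equiv (Equiv.mulRight ⟨_, hmem⟩) _ _ fun w => ?_
  simp only [Equiv.coe_mulRight, Subgroup.coe_mul, sgn_mul, sgn_reflection hR,
    LinearEquiv.mul_apply]
  ring

/-- The kernel `e^{⟨x, y⟩}` is positive semidefinite, and the alternating sum is a projection. -/
lemma altSum_self_nonneg (x : E) : 0 ≤ altSum b J x x := by
  have hpow : ∀ m : ℕ, 0 ≤ ∑ v : b.weyl J, ∑ w : b.weyl J,
      sgn v.1 * sgn w.1 * (inner ℝ (v.1 x) (w.1 x) : ℝ) ^ m := by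
    intro m
    let e := stdOrthonormalBasis ℝ E
    have h : ∀ v w : b.weyl J, sgn v.1 * sgn w.1 * (inner ℝ (v.1 x) (w.1 x) : ℝ) ^ m =
        ∑ p : Fin m → Fin (Module.finrank ℝ E),
          (sgn v.1 * ∏ k, inner ℝ (v.1 x) (e (p k))) *
            (sgn w.1 * ∏ k, inner ℝ (w.1 x) (e (p k))) := by
      intro v w
      rw [← e.sum_inner_mul_inner, Fintype.sum_pow, Finset.mul_sum]
      refine Finset.sum_congr rfl fun p _ => ?_
      simp only [Finset.prod_mul_distrib, real_inner_comm (w.1 x)]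
      ring
    simp only [h]
    have hcomm : ∀ v : b.weyl J, ∑ w : b.weyl J, ∑ p : Fin m → Fin (Module.finrank ℝ E),
        (sgn v.1 * ∏ k, (inner ℝ (v.1 x) (e (p k)) : ℝ)) *
          (sgn w.1 * ∏ k, (inner ℝ (w.1 x) (e (p k)) : ℝ)) =
        ∑ p : Fin m → Fin (Module.finrank ℝ E), ∑ w : b.weyl J,
          (sgn v.1 * ∏ k, (inner ℝ (v.1 x) (e (p k)) : ℝ)) *
          (sgn w.1 * ∏ k, (inner ℝ (w.1 x) (e (p k)) : ℝ)) := fun v => Finset.sum_comm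
    simp only [hcomm]
    rw [Finset.sum_comm]
    refine Finset.sum_nonneg fun p _ => ?_
    simp only [← Finset.mul_sum, ← Finset.sum_mul]
    exact mul_self_nonneg _
  have hexp : 0 ≤ ∑ v : b.weyl J, ∑ w : b.weyl J,
      sgn v.1 * sgn w.1 * Real.exp (inner ℝ (v.1 x) (w.1 x)) := by
    have hs : HasSum (fun m : ℕ => ∑ v : b.weyl J, ∑ w : b.weyl J,
        sgn v.1 * sgn w.1 * ((inner ℝ (v.1 x) (w.1 x) : ℝ) ^ m / m.factorial))
        (∑ v : b.weyl J, ∑ w : b.weyl J,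
          sgn v.1 * sgn w.1 * Real.exp (inner ℝ (v.1 x) (w.1 x))) := by
      refine hasSum_sum fun v _ => hasSum_sum fun w _ => HasSum.mul_left _ ?_
      rw [Real.exp_eq_exp_ℝ]
      exact NormedSpace.expSeries_div_hasSum_exp (inner ℝ (v.1 x) (w.1 x) : ℝ)
    refine hs.nonneg fun m => ?_
    have := div_nonneg (hpow m) (Nat.cast_nonneg (α := ℝ) m.factorial)
    simpa only [Finset.sum_div, mul_div_assoc] using this
  have hinv : ∀ v : b.weyl J, ∑ w : b.weyl J,
      sgn v.1 * sgn w.1 * Real.exp (inner ℝ (v.1 x) (w.1 x)) = altSum b J x x := by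
    intro v
    have h1 : ∀ w : b.weyl J, sgn v.1 * sgn w.1 * Real.exp (inner ℝ (v.1 x) (w.1 x)) =
        sgn v.1 * (sgn w.1 * Real.exp (inner ℝ (w.1 x) (v.1 x))) := fun w => by
      rw [real_inner_comm, mul_assoc]
    have h2 := odd_weyl (b := b) (J := J) hR (f := fun y => altSum b J x y) (fun j hj y => by
      rw [altSum_comm hR, altSum_reflection_left hR hj, altSum_comm hR]) v.2 x
    simp only [h1, ← Finset.mul_sum]
    change sgn v.1 * altSum b J x (v.1 x) = _
    rw [h2, ← mul_assoc, sgn_mul_self hR v.2, one_mul]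
  simp only [hinv, Finset.sum_const, nsmul_eq_mul] at hexp
  have hcard : (0 : ℝ) < (Finset.univ : Finset (b.weyl J)).card := by
    exact_mod_cast Finset.card_pos.mpr ⟨1, Finset.mem_univ _⟩
  exact nonneg_of_mul_nonneg_right hexp hcard

open scoped ContDiff in
/-- The alternating sum is divisible by the product of the coroots in both variables. -/
lemma exists_altSum_eq [Fintype I] [R.IsCrystallographic] (b : SimpleRoots R I) (J : Finset I) :
    ∃ K : E × E → ℝ, ContDiff ℝ ∞ K ∧
      ∀ θ x, altSum b J θ x = delta b J θ * delta b J x * K (θ, x) := by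
  let l : ι ⊕ ι → (E × E) →L[ℝ] ℝ :=
    Sum.elim (fun i => (innerSL ℝ (R.coroot i)).comp (ContinuousLinearMap.fst ℝ E E))
      (fun i => (innerSL ℝ (R.coroot i)).comp (ContinuousLinearMap.snd ℝ E E))
  have hl1 : ∀ i (z : E × E), l (Sum.inl i) z = inner ℝ (R.coroot i) z.1 := fun _ _ => rfl
  have hl2 : ∀ i (z : E × E), l (Sum.inr i) z = inner ℝ (R.coroot i) z.2 := fun _ _ => rfl
  have hself : ∀ i, (inner ℝ (R.coroot i) (R.coroot i) : ℝ) ≠ 0 := fun i =>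
    inner_self_ne_zero.mpr (R.ne_zero' i)
  have hroot : ∀ i x, (inner ℝ (R.coroot i) x : ℝ) = 0 → (inner ℝ x (R.root i) : ℝ) = 0 := by
    intro i x h
    rw [real_inner_comm, hR.inner_coroot] at h
    exact (mul_eq_zero.mp h).resolve_left (coroot_scale_pos R i).ne'
  have hl0 : ∀ i ∈ (posIndiv b J).disjSum (posIndiv b J), l i ≠ 0 := by
    rintro (i | i) - h0
    · have := hl1 i (R.coroot i, 0)
      rw [h0] at this
      exact hself i this.symm
    · have := hl2 i (0, R.coroot i)
      rw [h0] at this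
      exact hself i this.symm
  have hne : ∀ i ∈ (posIndiv b J).disjSum (posIndiv b J),
      ∀ k ∈ (posIndiv b J).disjSum (posIndiv b J), i ≠ k → ∃ y, l i y = 0 ∧ l k y ≠ 0 := by
    rintro (i | i) hi (k | k) hk hik
    · rw [Finset.inl_mem_disjSum, mem_posIndiv] at hi hk
      obtain ⟨y, hy⟩ := exists_inner_eq_zero_of_ne hR hi.1 hk.1 (fun h => hik (h ▸ rfl))
      exact ⟨(y, 0), hy⟩
    · exact ⟨(0, R.coroot k), by rw [hl1]; simp, by rw [hl2]; exact hself k⟩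
    · exact ⟨(R.coroot k, 0), by rw [hl2]; simp, by rw [hl1]; exact hself k⟩
    · rw [Finset.inr_mem_disjSum, mem_posIndiv] at hi hk
      obtain ⟨y, hy⟩ := exists_inner_eq_zero_of_ne hR hi.1 hk.1 (fun h => hik (h ▸ rfl))
      exact ⟨(0, y), hy⟩
  have hzero : ∀ i ∈ (posIndiv b J).disjSum (posIndiv b J), ∀ z, l i z = 0 →
      altSum b J z.1 z.2 = 0 := by
    rintro (i | i) hi z hz
    · rw [Finset.inl_mem_disjSum, mem_posIndiv] at hi
      exact SimpleRoots.eq_zero_of_odd (b := b) hR (f := fun θ => altSum b J θ z.2)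
        (fun j hj x => altSum_reflection_left hR hj x z.2) hi.1.1 hi.2 (hroot i _ hz)
    · rw [Finset.inr_mem_disjSum, mem_posIndiv] at hi
      refine SimpleRoots.eq_zero_of_odd (b := b) hR (f := fun x => altSum b J z.1 x)
        (fun j hj x => ?_) hi.1.1 hi.2 (hroot i _ hz)
      rw [altSum_comm hR, altSum_reflection_left hR hj, altSum_comm hR]
  obtain ⟨K, hK, h⟩ := exists_contDiff_eq_prod_mul _ l hl0 hne
    (contDiff_altSum.of_le (by simp)) hzero
  refine ⟨K, hK, fun θ x => ?_⟩
  rw [h (θ, x), Finset.prod_disjSum]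
  simp only [hl1, hl2, delta, real_inner_comm]

/-- The lowest-order term of the alternating sum is a non-negative multiple of the product of the
coroots in both variables. -/
lemma exists_tendsto_altSum_div [Fintype I] [R.IsCrystallographic] (b : SimpleRoots R I)
    (J : Finset I) : ∃ c : ℝ, 0 ≤ c ∧ ∀ x, Tendsto (fun θ => altSum b J θ x / delta b J θ)
      (𝓝[regular b J] 0) (𝓝 (c * delta b J x)) := by
  obtain ⟨K, hK, h⟩ := exists_altSum_eq hR b J
  have hv := (delta_heightVec_pos (b := b) (J := J) hR).ne'
  -- By homogeneity `K (t θ, x) = K (θ, t x)` away from the hyperplanes.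
  have hconst : ∀ x, delta b J x ≠ 0 → K (0, x) = K (b.heightVec, 0) := by
    intro x hx
    have h1 : Tendsto (fun t : ℝ => K (t • b.heightVec, x)) (𝓝[≠] 0) (𝓝 (K (0, x))) := by
      have : Continuous fun t : ℝ => K (t • b.heightVec, x) := hK.continuous.comp (by fun_prop)
      exact (this.tendsto' 0 _ (by simp)).mono_left nhdsWithin_le_nhds
    have h2 : Tendsto (fun t : ℝ => K (b.heightVec, t • x)) (𝓝[≠] 0)
        (𝓝 (K (b.heightVec, 0))) := by
      have : Continuous fun t : ℝ => K (b.heightVec, t • x) := hK.continuous.comp (by fun_prop)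
      exact (this.tendsto' 0 _ (by simp)).mono_left nhdsWithin_le_nhds
    refine tendsto_nhds_unique (h1.congr' ?_) h2
    filter_upwards [self_mem_nhdsWithin] with t ht
    have h3 := altSum_smul_left (b := b) (J := J) t b.heightVec x
    rw [h, h, delta_smul, delta_smul] at h3
    have ht' : t ^ (posIndiv b J).card ≠ 0 := pow_ne_zero _ ht
    have h4 : t ^ (posIndiv b J).card * delta b J b.heightVec * delta b J x *
        (K (t • b.heightVec, x) - K (b.heightVec, t • x)) = 0 := by linear_combination h3
    exact sub_eq_zero.mp ((mul_eq_zero.mp h4).resolve_left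
      (mul_ne_zero (mul_ne_zero ht' hv) hx))
  refine ⟨K (b.heightVec, 0), ?_, fun x => ?_⟩
  · have h1 : Tendsto (fun t : ℝ => K (0, t • b.heightVec)) (𝓝[≠] 0) (𝓝 (K (0, 0))) := by
      have : Continuous fun t : ℝ => K (0, t • b.heightVec) := hK.continuous.comp (by fun_prop)
      exact (this.tendsto' 0 _ (by simp)).mono_left nhdsWithin_le_nhds
    have h2 : Tendsto (fun t : ℝ => K (t • b.heightVec, t • b.heightVec)) (𝓝[≠] 0)
        (𝓝 (K (0, 0))) := by
      have : Continuous fun t : ℝ => K (t • b.heightVec, t • b.heightVec) :=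
        hK.continuous.comp (by fun_prop)
      exact (this.tendsto' 0 _ (by simp)).mono_left nhdsWithin_le_nhds
    have h3 : K (b.heightVec, 0) = K (0, 0) := by
      refine tendsto_nhds_unique (tendsto_const_nhds.congr' ?_) h1
      filter_upwards [self_mem_nhdsWithin] with t ht
      refine (hconst _ ?_).symm
      rw [delta_smul]
      exact mul_ne_zero (pow_ne_zero _ ht) hv
    rw [h3]
    refine ge_of_tendsto h2 ?_
    filter_upwards [self_mem_nhdsWithin] with t ht
    have h4 := altSum_self_nonneg (b := b) (J := J) hR (t • b.heightVec)
    rw [h] at h4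
    refine nonneg_of_mul_nonneg_right h4 (mul_self_pos.mpr ?_)
    rw [delta_smul]
    exact mul_ne_zero (pow_ne_zero _ ht) hv
  · have h1 : Tendsto (fun θ => K (θ, x) * delta b J x) (𝓝[regular b J] 0)
        (𝓝 (K (0, x) * delta b J x)) := by
      have : Continuous fun θ => K (θ, x) * delta b J x :=
        (hK.continuous.comp (by fun_prop : Continuous fun θ : E => (θ, x))).mul continuous_const
      exact this.continuousAt.mono_left nhdsWithin_le_nhds
    have h2 : K (b.heightVec, 0) * delta b J x = K (0, x) * delta b J x := by
      by_cases hx : delta b J x = 0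
      · simp [hx]
      · rw [hconst x hx]
    rw [h2]
    refine h1.congr' ?_
    filter_upwards [self_mem_nhdsWithin] with θ hθ
    have := delta_ne_zero_of_regular hθ
    rw [h]
    field_simp

end Alternating

/-! ### Limits at the origin -/

/-- An element of the group algebra is invariant under the simple reflections of `W_J`. -/
def IsInvariant (b : SimpleRoots R I) (J : Finset I) (n : AddMonoidAlgebra ℝ E) : Prop :=
  ∀ j ∈ J, ∀ θ, evalExp (R.reflection (b.idx j) θ) n = evalExp θ n

/-- The denominator `2 sinh (u / 2)` of the symmetrized `c`-function. -/
def sinhHalf (u : ℝ) : ℝ := Real.exp (u / 2) - Real.exp (-(u / 2))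

lemma sinhHalf_neg (u : ℝ) : sinhHalf (-u) = -sinhHalf u := by
  simp [sinhHalf, neg_div]

lemma tendsto_sinhHalf_div : Tendsto (fun u => sinhHalf u / u) (𝓝[≠] 0) (𝓝 1) := by
  have h : HasDerivAt sinhHalf 1 0 := by
    have h1 : HasDerivAt (fun u : ℝ => u / 2) (1 / 2) 0 := (hasDerivAt_id 0).div_const 2
    have h2 := h1.exp.sub h1.neg.exp
    convert! h2 using 1
    norm_num
  have h3 := hasDerivAt_iff_tendsto_slope.mp h
  refine h3.congr fun u => ?_
  simp [slope_def_field, sinhHalf]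

lemma continuous_evalExp (n : AddMonoidAlgebra ℝ E) : Continuous fun θ : E => evalExp θ n := by
  induction n using AddMonoidAlgebra.induction_linear with
  | zero => simpa using continuous_const
  | add m n hm hn =>
    simp only [map_add]
    exact hm.add hn
  | single v a => simp only [evalExp_single]; fun_prop

section Limits

variable [FiniteDimensional ℝ E] [Fintype ι] {b : SimpleRoots R I} {J : Finset I}

lemma tendsto_prod_sinhHalf_div : Tendsto
    (fun θ => (∏ i ∈ posIndiv b J, sinhHalf (inner ℝ θ (R.coroot i))) / delta b J θ)
    (𝓝[regular b J] 0) (𝓝 1) := by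
  have h : Tendsto (fun θ => ∏ i ∈ posIndiv b J,
      (sinhHalf (inner ℝ θ (R.coroot i)) / inner ℝ θ (R.coroot i)))
      (𝓝[regular b J] 0) (𝓝 (∏ i ∈ posIndiv b J, 1)) := by
    refine tendsto_finsetProd _ fun i hi => tendsto_sinhHalf_div.comp ?_
    refine tendsto_nhdsWithin_of_tendsto_nhds_of_eventually_within _ ?_ ?_
    · have : Continuous fun θ : E => (inner ℝ θ (R.coroot i) : ℝ) := by fun_prop
      exact (this.tendsto' 0 0 (by simp)).mono_left nhdsWithin_le_nhds
    · filter_upwards [self_mem_nhdsWithin] with θ hθ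
      exact hθ i (mem_posIndiv.mp hi).2
  simpa [delta, Finset.prod_div_distrib] using h

variable (hR : IsEuclidean R) [Fintype I] [R.IsCrystallographic]
include hR

lemma exists_pos_tendsto_altSum_div (b : SimpleRoots R I) (J : Finset I) :
    ∃ c : ℝ, 0 < c ∧ ∀ x, Tendsto (fun θ => altSum b J θ x / delta b J θ)
      (𝓝[regular b J] 0) (𝓝 (c * delta b J x)) := by
  obtain ⟨c, hc, h⟩ := exists_tendsto_altSum_div hR b J
  refine ⟨c, hc.lt_of_ne' ?_, h⟩
  rintro rfl
  -- Testing on the exponential sum `∏ 2 sinh (⟨·, α^∨⟩ / 2)`, whose antisymmetrization is known.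
  set n : AddMonoidAlgebra ℝ E := ∏ i ∈ posIndiv b J,
    (AddMonoidAlgebra.single ((1 / 2 : ℝ) • R.coroot i) 1 -
      AddMonoidAlgebra.single (-((1 / 2 : ℝ) • R.coroot i)) 1) with hn
  have heval : ∀ θ, evalExp θ n = ∏ i ∈ posIndiv b J, sinhHalf (inner ℝ θ (R.coroot i)) := by
    intro θ
    rw [hn, map_prod]
    refine Finset.prod_congr rfl fun i _ => ?_
    rw [map_sub, evalExp_single, evalExp_single, inner_neg_right, real_inner_smul_right, sinhHalf]
    ring_nf
  have hodd : ∀ j ∈ J, ∀ θ, evalExp (R.reflection (b.idx j) θ) n = -evalExp θ n := by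
    intro j hj θ
    rw [heval, heval, prod_odd_reflection hR sinhHalf_neg hj]
  have h1 : ∀ θ, shift n (altSum b J θ) 0 =
      Fintype.card (b.weyl J) * ∏ i ∈ posIndiv b J, sinhHalf (inner ℝ θ (R.coroot i)) := by
    intro θ
    rw [shift_altSum, ← heval]
    have : ∀ w : b.weyl J, sgn w.1 * (evalExp (w.1 θ) n * Real.exp (inner ℝ (w.1 θ) 0)) =
        evalExp θ n := by
      intro w
      rw [odd_weyl (f := fun θ => evalExp θ n) hR hodd w.2, inner_zero_right, Real.exp_zero, mul_one, ← mul_assoc,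
        sgn_mul_self hR w.2, one_mul]
    simp only [this, Finset.sum_const, nsmul_eq_mul, Finset.card_univ]
  have h2 := tendsto_shift n (h₀ := 0) (h := fun θ => (delta b J θ)⁻¹ • altSum b J θ)
    (l := 𝓝[regular b J] 0) (fun x => by simpa [div_eq_inv_mul] using h x) 0
  have h3 := (tendsto_prod_sinhHalf_div (b := b) (J := J)).const_mul
    (Fintype.card (b.weyl J) : ℝ)
  have := neBot_regular (b := b) (J := J) hR
  have h4 := tendsto_nhds_unique h3 (h2.congr fun θ => by
    rw [map_smul, Pi.smul_apply, h1, smul_eq_mul]; ring)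
  rw [map_zero, Pi.zero_apply, mul_one, Nat.cast_eq_zero] at h4
  exact Fintype.card_ne_zero h4

/-- Invariant shift operators act on the product of the coroots by scalars. -/
lemma IsInvariant.shift_delta {n : AddMonoidAlgebra ℝ E} (hn : IsInvariant b J n) :
    shift n (delta b J) = evalExp 0 n • delta b J := by
  obtain ⟨c, hc, h⟩ := exists_pos_tendsto_altSum_div hR b J
  ext x
  have h1 := tendsto_shift n (h₀ := c • delta b J) (h := fun θ => (delta b J θ)⁻¹ • altSum b J θ)
    (l := 𝓝[regular b J] 0) (fun x => by simpa [div_eq_inv_mul] using h x) x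
  have h2 : Tendsto (fun θ => evalExp θ n) (𝓝[regular b J] 0) (𝓝 (evalExp 0 n)) :=
    (continuous_evalExp n).continuousAt.mono_left nhdsWithin_le_nhds
  have := neBot_regular (b := b) (J := J) hR
  have h3 := tendsto_nhds_unique h1 ((h2.mul (h x)).congr fun θ => by
    have : shift n (altSum b J θ) x = evalExp θ n * altSum b J θ x := by
      rw [shift_altSum, altSum, Finset.mul_sum]
      refine Finset.sum_congr rfl fun w _ => ?_
      rw [even_weyl (f := fun θ => evalExp θ n) hn w.2]; ring
    rw [map_smul, Pi.smul_apply, this, smul_eq_mul]; ring)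
  rw [map_smul, Pi.smul_apply, smul_eq_mul] at h3
  refine mul_left_cancel₀ hc.ne' ?_
  rw [h3, Pi.smul_apply, smul_eq_mul]; ring

end Limits

/-! ### The ground polynomials -/

/-- The element `e^{α^∨/2} + p_α - t_α e^{-α^∨/2}` of the group algebra: the numerator of the factor
of the `c`-function at `α`, multiplied by `e^{α^∨/2}`. -/
def rootOp (R : RootPairing ι ℝ E E) (p t : ι → ℝ) (i : ι) : AddMonoidAlgebra ℝ E :=
  AddMonoidAlgebra.single ((1 / 2 : ℝ) • R.coroot i) 1 + AddMonoidAlgebra.single 0 (p i) -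
    AddMonoidAlgebra.single (-((1 / 2 : ℝ) • R.coroot i)) (t i)

/-- The product of the elements `rootOp` over a set of roots. -/
def symbol (R : RootPairing ι ℝ E E) (p t : ι → ℝ) (S : Finset ι) : AddMonoidAlgebra ℝ E :=
  ∏ i ∈ S, rootOp R p t i

lemma evalExp_rootOp (p t : ι → ℝ) (i : ι) (θ : E) : evalExp θ (rootOp R p t i) =
    Real.exp (inner ℝ θ (R.coroot i) / 2) + p i -
      t i * Real.exp (-(inner ℝ θ (R.coroot i) / 2)) := by
  rw [rootOp, map_sub, map_add, evalExp_single, evalExp_single, evalExp_single, inner_neg_right,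
    real_inner_smul_right, inner_zero_right, Real.exp_zero]
  ring_nf

lemma shift_rootOp (p t : ι → ℝ) (i : ι) (f : E → ℝ) (x : E) : shift (rootOp R p t i) f x =
    f (x + (1 / 2 : ℝ) • R.coroot i) + p i * f x - t i * f (x - (1 / 2 : ℝ) • R.coroot i) := by
  simp [rootOp, sub_eq_add_neg]

lemma evalExp_zero_symbol (p t : ι → ℝ) (S : Finset ι) :
    evalExp 0 (symbol R p t S) = ∏ i ∈ S, (1 + p i - t i) := by
  simp [symbol, map_prod, evalExp_rootOp]

lemma tendsto_shift_symbol {T : Type*} {l : Filter T} {p t : T → ι → ℝ} {p₀ t₀ : ι → ℝ}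
    (hp : ∀ i, Tendsto (fun s => p s i) l (𝓝 (p₀ i)))
    (ht : ∀ i, Tendsto (fun s => t s i) l (𝓝 (t₀ i))) {h : T → E → ℝ}
    {h₀ : E → ℝ} (hh : ∀ x, Tendsto (fun s => h s x) l (𝓝 (h₀ x))) (S : Finset ι) (x : E) :
    Tendsto (fun s => shift (symbol R (p s) (t s) S) (h s) x) l
      (𝓝 (shift (symbol R p₀ t₀ S) h₀ x)) := by
  classical
  induction S using Finset.induction_on generalizing x with
  | empty => simpa [symbol] using hh x
  | insert i S hi ih =>
    have : ∀ p t : ι → ℝ, symbol R p t (insert i S) = rootOp R p t i * symbol R p t S :=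
      fun p t => Finset.prod_insert hi
    simp only [this, shift_mul_apply, shift_rootOp]
    exact ((ih _).add ((hp i).mul (ih x))).sub ((ht i).mul (ih _))

section Asymptotics

variable [FiniteDimensional ℝ E] [Fintype ι]

/-- The polynomial `𝒫_J` up to a positive factor, for general parameters: the symmetrized
numerator of the `c`-function, as a shift operator, applied to the product of the coroots. -/
def groundPoly (b : SimpleRoots R I) (J : Finset I) (p t : ι → ℝ) (x : E) : ℝ :=
  shift (symbol R p t (posIndiv b J)) (delta b J) x

variable {b : SimpleRoots R I} {J K : Finset I}

lemma delta_translate (hR : IsEuclidean R) [Fintype I] {x y : E}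
    (h : ∀ k ∈ J, (inner ℝ x (R.root (b.idx k)) : ℝ) = inner ℝ y (R.root (b.idx k))) (z : E) :
    delta b J (z + x) = delta b J (z + y) := by
  refine Finset.prod_congr rfl fun i hi => ?_
  rw [hR.inner_coroot, hR.inner_coroot, inner_add_left, inner_add_left,
    (mem_posIndiv.mp hi).2.inner_eq_sum x, (mem_posIndiv.mp hi).2.inner_eq_sum y]
  congr 2
  exact Finset.sum_congr rfl fun k hk => by rw [h k hk]

/-- The ground polynomial of `J` only depends on the coordinates in `J`. -/
lemma groundPoly_congr (hR : IsEuclidean R) [Fintype I] (p t : ι → ℝ) {x y : E}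
    (h : ∀ k ∈ J, (inner ℝ x (R.root (b.idx k)) : ℝ) = inner ℝ y (R.root (b.idx k))) :
    groundPoly b J p t x = groundPoly b J p t y := by
  rw [groundPoly, groundPoly, ← zero_add x, ← zero_add y, ← shift_translate, ← shift_translate]
  simp only [delta_translate hR h]

variable (hR : IsEuclidean R) [R.IsCrystallographic]
include hR

omit [FiniteDimensional ℝ E] [Fintype ι] [R.IsCrystallographic] in
lemma isInvariant_symbol {S : Finset ι} {p t : ι → ℝ}
    (hS : ∀ j ∈ J, ∀ i ∈ S, R.reflectionPerm (b.idx j) i ∈ S)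
    (hp : ∀ i j, p (R.reflectionPerm j i) = p i) (ht : ∀ i j, t (R.reflectionPerm j i) = t i) :
    IsInvariant b J (symbol R p t S) := by
  intro j hj θ
  rw [symbol, map_prod, map_prod, ← prod_reflectionPerm (hS j hj) fun i => evalExp θ _]
  refine Finset.prod_congr rfl fun i _ => ?_
  rw [evalExp_rootOp, evalExp_rootOp, hR.coroot_reflectionPerm, hR.inner_reflection_left, hp, ht]

variable [Fintype I]

lemma shift_symbol_delta [DecidableEq ι] {p t : ι → ℝ} (hKJ : K ⊆ J)
    (hp : ∀ i j, p (R.reflectionPerm j i) = p i) (ht : ∀ i j, t (R.reflectionPerm j i) = t i)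
    (x : E) : shift (symbol R p t (posIndiv b J)) (delta b K) x =
      (∏ i ∈ posIndiv b J \ posIndiv b K, (1 + p i - t i)) * groundPoly b K p t x := by
  have h1 : symbol R p t (posIndiv b J) =
      symbol R p t (posIndiv b K) * symbol R p t (posIndiv b J \ posIndiv b K) := by
    rw [mul_comm]; exact (Finset.prod_sdiff (posIndiv_mono hKJ)).symm
  have h2 : IsInvariant b K (symbol R p t (posIndiv b J \ posIndiv b K)) :=
    isInvariant_symbol hR (fun j hj i hi => reflectionPerm_mem_sdiff hR hKJ hj hi) hp ht
  rw [h1, shift_mul_apply, h2.shift_delta hR, map_smul, Pi.smul_apply, evalExp_zero_symbol,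
    smul_eq_mul, groundPoly]

open Asymptotics in
/-- The asymptotics of the ground polynomials when the coordinates in `K` stay bounded and the
other positive roots of `Φ_J` tend to infinity. To leading order the factor
`∏ ⟨x, α^∨⟩` over `Φ_J⁺⁺ \ Φ_K` is unaffected by the shifts, and the remaining invariant part of the
shift operator acts on the product over `Φ_K⁺⁺` by a scalar. -/
lemma tendsto_groundPoly_div_sub [DecidableEq ι] {T : Type*} {l : Filter T} {p t : T → ι → ℝ}
    {p₀ t₀ : ι → ℝ} (hKJ : K ⊆ J)
    (hp : ∀ i, Tendsto (fun s => p s i) l (𝓝 (p₀ i)))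
    (ht : ∀ i, Tendsto (fun s => t s i) l (𝓝 (t₀ i)))
    (hpi : ∀ s i j, p s (R.reflectionPerm j i) = p s i)
    (hti : ∀ s i j, t s (R.reflectionPerm j i) = t s i) {x : T → E}
    (hK : ∀ k ∈ K, (fun s => (inner ℝ (x s) (R.root (b.idx k)) : ℝ)) =O[l] fun _ => (1 : ℝ))
    (hJ : ∀ i ∈ posIndiv b J \ posIndiv b K,
      Tendsto (fun s => (inner ℝ (x s) (R.coroot i) : ℝ)) l atTop) :
    Tendsto (fun s => groundPoly b J (p s) (t s) (x s) /
        (∏ i ∈ posIndiv b J \ posIndiv b K, inner ℝ (x s) (R.coroot i)) -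
      (∏ i ∈ posIndiv b J \ posIndiv b K, (1 + p s i - t s i)) *
        groundPoly b K (p s) (t s) (x s)) l (𝓝 0) := by
  set D : E → ℝ := fun y => ∏ i ∈ posIndiv b J \ posIndiv b K, inner ℝ y (R.coroot i) with hD
  have hdelta : ∀ y, delta b J y = delta b K y * D y := fun y => by
    rw [mul_comm]; exact (Finset.prod_sdiff (posIndiv_mono hKJ)).symm
  have hratio : ∀ z, Tendsto (fun s => D (z + x s) / D (x s)) l (𝓝 1) := by
    intro z
    have h1 : Tendsto (fun s => ∏ i ∈ posIndiv b J \ posIndiv b K,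
        ((inner ℝ (z + x s) (R.coroot i) : ℝ) / inner ℝ (x s) (R.coroot i))) l
        (𝓝 (∏ i ∈ posIndiv b J \ posIndiv b K, 1)) := by
      refine tendsto_finsetProd _ fun i hi => ?_
      have h2 := ((hJ i hi).const_div_atTop (inner ℝ z (R.coroot i))).add_const 1
      rw [zero_add] at h2
      refine h2.congr' ?_
      filter_upwards [(hJ i hi).eventually_ne_atTop 0] with s hs
      rw [inner_add_left, add_div, div_self hs]
    simpa only [hD, Finset.prod_div_distrib, Finset.prod_const_one] using h1
  have hbdd : ∀ z, (fun s => delta b K (z + x s)) =O[l] fun _ => (1 : ℝ) := by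
    intro z
    have h1 : ∀ i ∈ posIndiv b K,
        (fun s => (inner ℝ (z + x s) (R.coroot i) : ℝ)) =O[l] fun _ => (1 : ℝ) := by
      intro i hi
      simp only [inner_add_left, hR.inner_coroot (x _), (mem_posIndiv.mp hi).2.inner_eq_sum (x _)]
      refine (isBigO_const_const _ one_ne_zero l).add ((IsBigO.fun_sum fun k hk => ?_).const_mul_left _)
      exact (hK k hk).const_mul_left _
    have h2 : (fun s => ∏ i ∈ posIndiv b K, (inner ℝ (z + x s) (R.coroot i) : ℝ)) =O[l]
        fun _ => ∏ i ∈ posIndiv b K, (1 : ℝ) := IsBigO.finsetProd h1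
    rw [Finset.prod_const_one] at h2
    exact h2
  have hlim : ∀ z, Tendsto (fun s => delta b K (z + x s) * (D (z + x s) / D (x s) - 1)) l
      (𝓝 ((0 : E → ℝ) z)) := by
    intro z
    have h1 : (fun s => D (z + x s) / D (x s) - 1) =o[l] fun _ => (1 : ℝ) := by
      rw [isLittleO_one_iff]
      simpa using (hratio z).sub_const 1
    have h2 := (hbdd z).mul_isLittleO h1
    simp only [mul_one] at h2
    exact (isLittleO_one_iff ℝ).mp h2
  have h := tendsto_shift_symbol (R := R) hp ht hlim (posIndiv b J) 0
  rw [map_zero, Pi.zero_apply] at h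
  refine h.congr fun s => ?_
  have hfun : (fun z => delta b K (z + x s) * (D (z + x s) / D (x s) - 1)) =
      (D (x s))⁻¹ • (fun z => delta b J (z + x s)) - fun z => delta b K (z + x s) := by
    funext z
    simp only [Pi.sub_apply, Pi.smul_apply, smul_eq_mul, hdelta]
    ring
  rw [hfun, map_sub, map_smul, Pi.sub_apply, Pi.smul_apply, shift_translate, shift_translate,
    zero_add, shift_symbol_delta hR hKJ (hpi s) (hti s), smul_eq_mul, div_eq_inv_mul]
  rfl

end Asymptotics

/-! ### Straightening -/

/-- The conditions on the parameters `p = b - a` and `t = a b` of the factors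
`(1 - a X) (1 + b X)` under which the ground polynomials are positive. -/
structure Admissible (R : RootPairing ι ℝ E E) (p t : ι → ℝ) : Prop where
  p_invariant : ∀ i j, p (R.reflectionPerm j i) = p i
  t_invariant : ∀ i j, t (R.reflectionPerm j i) = t i
  p_nonneg : ∀ i, 0 ≤ p i
  t_nonneg : ∀ i, 0 ≤ t i
  t_lt : ∀ i, t i < 1 + p i
  p_eq_zero : ∀ i, (2 : ℝ) • R.root i ∉ Set.range R.root → p i = 0

/-- Scaling `a` and `b` by `s ≤ 1` preserves admissibility. -/
lemma Admissible.scale {p t : ι → ℝ} (h : Admissible R p t) {s : ℝ} (h0 : 0 ≤ s) (h1 : s ≤ 1) :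
    Admissible R (fun i => s * p i) (fun i => s ^ 2 * t i) where
  p_invariant i j := by rw [h.p_invariant]
  t_invariant i j := by rw [h.t_invariant]
  p_nonneg i := mul_nonneg h0 (h.p_nonneg i)
  t_nonneg i := mul_nonneg (sq_nonneg s) (h.t_nonneg i)
  t_lt i := by
    rcases h0.eq_or_lt with rfl | h0
    · simp
    · have h2 : s ^ 2 * t i < s ^ 2 * (1 + p i) := mul_lt_mul_of_pos_left (h.t_lt i) (by positivity)
      have h3 : s ^ 2 ≤ s := by nlinarith
      have h4 : s ^ 2 * p i ≤ s * p i := mul_le_mul_of_nonneg_right h3 (h.p_nonneg i)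
      linarith
  p_eq_zero i hi := by rw [h.p_eq_zero i hi, mul_zero]

lemma Admissible.prod_pos {p t : ι → ℝ} (h : Admissible R p t) (S : Finset ι) :
    0 < ∏ i ∈ S, (1 + p i - t i) :=
  Finset.prod_pos fun i _ => sub_pos.mpr (h.t_lt i)

omit [InnerProductSpace ℝ E] in
lemma shift_domCongr (e : E ≃+ E) (n : AddMonoidAlgebra ℝ E) (f : E → ℝ) (x : E) :
    shift (AddMonoidAlgebra.domCongr ℝ ℝ e n) f (e x) = shift n (fun y => f (e y)) x := by
  induction n using AddMonoidAlgebra.induction_linear with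
  | zero => simp
  | add m n hm hn => simp [hm, hn]
  | single v a => simp

lemma shift_symbol_reflection (hR : IsEuclidean R) {p t : ι → ℝ} (h : Admissible R p t)
    {S : Finset ι} {j : ι} (hS : ∀ i ∈ S, R.reflectionPerm j i ∈ S) (f : E → ℝ) (x : E) :
    shift (symbol R p t S) f (R.reflection j x) =
      shift (symbol R p t S) (fun y => f (R.reflection j y)) x := by
  have h1 : AddMonoidAlgebra.domCongr ℝ ℝ (R.reflection j).toAddEquiv (symbol R p t S) =
      symbol R p t S := by
    rw [symbol, map_prod, ← prod_reflectionPerm hS (rootOp R p t)]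
    refine Finset.prod_congr rfl fun i _ => ?_
    simp [rootOp, hR.coroot_reflectionPerm, h.p_invariant, h.t_invariant]
  have h2 := shift_domCongr (R.reflection j).toAddEquiv (symbol R p t S) f x
  rwa [h1] at h2

section Ground

variable [FiniteDimensional ℝ E] [Fintype ι] {b : SimpleRoots R I} {J K : Finset I}

section Straightening

variable (hR : IsEuclidean R) [R.IsCrystallographic]
include hR

/-- Splitting off the factor of a simple root: the other factors act on `delta` to give a function
which is odd under the simple reflection. -/
lemma exists_odd_groundPoly {p t : ι → ℝ} (h : Admissible R p t) {j : I} (hj : j ∈ J) :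
    ∃ φ : E → ℝ, (∀ x, φ (R.reflection (b.idx j) x) = -φ x) ∧
      ∀ x, groundPoly b J p t x = φ (x + (1 / 2 : ℝ) • R.coroot (b.idx j)) + p (b.idx j) * φ x -
        t (b.idx j) * φ (x - (1 / 2 : ℝ) • R.coroot (b.idx j)) := by
  classical
  refine ⟨shift (symbol R p t ((posIndiv b J).erase (b.idx j))) (delta b J), fun x => ?_,
    fun x => ?_⟩
  · rw [shift_symbol_reflection hR h (fun i => reflectionPerm_mem_erase hR hj)]
    have : (fun y => delta b J (R.reflection (b.idx j) y)) = -delta b J :=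
      funext fun y => delta_reflection hR hj y
    rw [this, map_neg, Pi.neg_apply]
  · have : symbol R p t (posIndiv b J) =
        rootOp R p t (b.idx j) * symbol R p t ((posIndiv b J).erase (b.idx j)) :=
      (Finset.mul_prod_erase _ _ (idx_mem_posIndiv hj)).symm
    rw [groundPoly, this, shift_mul_apply, shift_rootOp]

/-- Straightening at `⟨x, α_j⟩ = -1`: the odd function `φ` of `exists_odd_groundPoly` vanishes at
`x + α_j^∨ / 2`, which is fixed by the reflection, and its other values pair up. -/
lemma groundPoly_of_inner_eq_neg_one {p t : ι → ℝ} (h : Admissible R p t) {j : I} (hj : j ∈ J)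
    {x : E} (hx : inner ℝ x (R.root (b.idx j)) = (-1 : ℝ)) :
    groundPoly b J p t x = t (b.idx j) * groundPoly b J p t (x + R.coroot (b.idx j)) -
      p (b.idx j) * groundPoly b J p t (x + (1 / 2 : ℝ) • R.coroot (b.idx j)) := by
  obtain ⟨φ, hodd, hφ⟩ := exists_odd_groundPoly (b := b) hR h hj
  have h2 := hR.inner_root_coroot_self (b.idx j)
  rw [real_inner_comm] at h2
  have key : ∀ s : ℝ, φ (x + (1 - s) • R.coroot (b.idx j)) = -φ (x + s • R.coroot (b.idx j)) := by
    intro s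
    rw [← hodd, hR.reflection_apply_coroot, inner_add_left, real_inner_smul_left, hx, h2]
    congr 1
    module
  set c := R.coroot (b.idx j)
  have e1 := key (1 / 2)
  have e2 := key 0
  have e3 := key (-(1 / 2))
  have e4 : φ (x + (1 / 2 : ℝ) • c) = 0 := by
    rw [show (1 : ℝ) - 1 / 2 = 1 / 2 by norm_num] at e1
    linarith
  rw [hφ, hφ, hφ]
  rw [show x + c + (1 / 2 : ℝ) • c = x + (1 - -(1 / 2) : ℝ) • c by module,
    show x + c - (1 / 2 : ℝ) • c = x + (1 / 2 : ℝ) • c by module,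
    show x + (1 / 2 : ℝ) • c + (1 / 2 : ℝ) • c = x + (1 - 0 : ℝ) • c by module,
    show x + (1 / 2 : ℝ) • c - (1 / 2 : ℝ) • c = x + (0 : ℝ) • c by module,
    show x - (1 / 2 : ℝ) • c = x + (-(1 / 2) : ℝ) • c by module,
    show φ (x + c) = φ (x + (1 - 0 : ℝ) • c) by congr 1; module,
    show φ x = φ (x + (0 : ℝ) • c) by congr 1; module, e2, e3, e4]
  ring

/-- Straightening at `⟨x, α_j⟩ = -2`, where the reflection sends `x` to `x + 2 α_j^∨`. -/
lemma groundPoly_of_inner_eq_neg_two {p t : ι → ℝ} (h : Admissible R p t) {j : I} (hj : j ∈ J)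
    (hp : p (b.idx j) = 0) {x : E} (hx : inner ℝ x (R.root (b.idx j)) = (-2 : ℝ)) :
    groundPoly b J p t x = t (b.idx j) * groundPoly b J p t (x + (2 : ℝ) • R.coroot (b.idx j)) -
      (1 - t (b.idx j)) * groundPoly b J p t (x + R.coroot (b.idx j)) := by
  obtain ⟨φ, hodd, hφ⟩ := exists_odd_groundPoly (b := b) hR h hj
  have h2 := hR.inner_root_coroot_self (b.idx j)
  rw [real_inner_comm] at h2
  have key : ∀ s : ℝ, φ (x + (2 - s) • R.coroot (b.idx j)) = -φ (x + s • R.coroot (b.idx j)) := by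
    intro s
    rw [← hodd, hR.reflection_apply_coroot, inner_add_left, real_inner_smul_left, hx, h2]
    congr 1
    module
  set c := R.coroot (b.idx j)
  have e1 := key (1 / 2)
  have e3 := key (-(1 / 2))
  rw [hφ, hφ, hφ, hp]
  rw [show x + (2 : ℝ) • c + (1 / 2 : ℝ) • c = x + (2 - -(1 / 2) : ℝ) • c by module,
    show x + (2 : ℝ) • c - (1 / 2 : ℝ) • c = x + (2 - 1 / 2 : ℝ) • c by module,
    show x + c + (1 / 2 : ℝ) • c = x + (2 - 1 / 2 : ℝ) • c by module,
    show x + c - (1 / 2 : ℝ) • c = x + (1 / 2 : ℝ) • c by module,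
    show x - (1 / 2 : ℝ) • c = x + (-(1 / 2) : ℝ) • c by module, e1, e3]
  ring

/-- The sum over translations by a set of coroots stable under `W_J` multiplies the ground
polynomial by the size of the set. -/
lemma sum_groundPoly_add_coroot [Fintype I] (p t : ι → ℝ) {O : Finset ι}
    (hO : ∀ j ∈ J, ∀ i ∈ O, R.reflectionPerm (b.idx j) i ∈ O) (x : E) :
    ∑ i ∈ O, groundPoly b J p t (x + R.coroot i) = O.card * groundPoly b J p t x := by
  set n : AddMonoidAlgebra ℝ E := ∑ i ∈ O, AddMonoidAlgebra.single (R.coroot i) 1 with hn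
  have hshift : ∀ f : E → ℝ, ∀ y, shift n f y = ∑ i ∈ O, f (y + R.coroot i) := by
    intro f y
    simp [hn, map_sum, LinearMap.sum_apply, Finset.sum_apply]
  have hinv : IsInvariant b J n := by
    intro j hj θ
    simp only [hn, map_sum, evalExp_single, one_mul]
    refine Finset.sum_nbij' (R.reflectionPerm (b.idx j)) (R.reflectionPerm (b.idx j)) (hO j hj)
      (hO j hj) (fun i _ => R.reflectionPerm_self _ i) (fun i _ => R.reflectionPerm_self _ i)
      fun i _ => ?_
    rw [hR.coroot_reflectionPerm, hR.inner_reflection_left]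
  have h0 : evalExp 0 n = O.card := by simp [hn, map_sum]
  have h1 := congrFun (congrArg (shift (symbol R p t (posIndiv b J))) (hinv.shift_delta hR)) x
  rw [map_smul, ← shift_mul_apply, mul_comm, shift_mul_apply, hshift, h0] at h1
  exact h1

end Straightening

/-! ### Positivity -/

/-- Integral vectors that are dominant for `J`. -/
def IsDominantOn (b : SimpleRoots R I) (J : Finset I) (x : E) : Prop :=
  ∀ k ∈ J, ∃ n : ℕ, inner ℝ x (R.root (b.idx k)) = (n : ℝ)

open Classical in
/-- The indices of the coroots of minimal length in `Φ_J`. -/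
def shortCoroots (b : SimpleRoots R I) (J : Finset I) : Finset ι :=
  {i | b.Mem J i ∧ ∀ k, b.Mem J k → ‖R.coroot i‖ ≤ ‖R.coroot k‖}

lemma mem_shortCoroots {i : ι} : i ∈ shortCoroots b J ↔
    b.Mem J i ∧ ∀ k, b.Mem J k → ‖R.coroot i‖ ≤ ‖R.coroot k‖ := by
  simp [shortCoroots]

omit [Fintype ι] in
lemma SimpleRoots.Mem.exists_of_not_mem {i : ι} (hi : b.Mem J i) (hiK : ¬ b.Mem K i)
    (hpos : b.IsPos i) : ∃ k ∈ J, k ∉ K ∧ 0 < b.basis.repr (R.root i) k := by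
  rw [mem_iff] at hi hiK
  push Not at hiK
  obtain ⟨k, hkK, hk⟩ := hiK
  refine ⟨k, ?_, hkK, (hpos.repr_nonneg k).lt_of_ne' hk⟩
  by_contra hkJ
  exact hk (hi k hkJ)

section Positivity

variable (hR : IsEuclidean R)
include hR

lemma reflectionPerm_mem_shortCoroots {j : I} (hj : j ∈ J) {i : ι} (hi : i ∈ shortCoroots b J) :
    R.reflectionPerm (b.idx j) i ∈ shortCoroots b J := by
  rw [mem_shortCoroots] at hi ⊢
  refine ⟨SimpleRoots.Mem.reflectionPerm hR (SimpleRoots.mem_idx hj) hi.1, fun k hk => ?_⟩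
  rw [hR.coroot_reflectionPerm, hR.norm_reflection]
  exact hi.2 k hk

/-- A shortest coroot pairs to at least `-1` with all roots other than its negative. -/
lemma coroot_eq_neg_of_inner_le {i k : ι} (hi : i ∈ shortCoroots b J) (hk : b.Mem J k)
    (h : inner ℝ (R.coroot i) (R.root k) ≤ (-2 : ℝ)) : R.coroot i = -R.coroot k := by
  have hs := coroot_scale_pos R k
  have h1 : (inner ℝ (R.coroot i) (R.coroot k) : ℝ) ≤ -inner ℝ (R.coroot k) (R.coroot k) := by
    have h2 := hR.inner_root_coroot_self k
    rw [hR.inner_coroot (R.coroot i), hR.inner_coroot (R.coroot k),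
      real_inner_comm (R.root k) (R.coroot k), h2]
    nlinarith
  have h3 : ‖R.coroot i‖ ^ 2 ≤ ‖R.coroot k‖ ^ 2 :=
    pow_le_pow_left₀ (norm_nonneg _) ((mem_shortCoroots.mp hi).2 k hk) 2
  rw [real_inner_self_eq_norm_sq] at h1
  have h4 := norm_add_sq_real (R.coroot i) (R.coroot k)
  have h5 : ‖R.coroot i + R.coroot k‖ ^ 2 = 0 := le_antisymm (by linarith) (sq_nonneg _)
  exact eq_neg_of_add_eq_zero_left (norm_eq_zero.mp (pow_eq_zero_iff two_ne_zero |>.mp h5))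

variable [Fintype I] [R.IsCrystallographic]

/-- A shortest coroot of maximal height in its `W_J`-orbit is dominant. -/
lemma exists_dominant_shortCoroot (hJ : J.Nonempty) :
    ∃ i ∈ shortCoroots b J, IsDominantOn b J (R.coroot i) := by
  classical
  obtain ⟨j, hj⟩ := hJ
  obtain ⟨i, hi, hmin⟩ := Finset.exists_min_image (Finset.univ.filter fun i => b.Mem J i)
    (fun i => ‖R.coroot i‖) ⟨b.idx j, by simpa using SimpleRoots.mem_idx hj⟩
  simp only [Finset.mem_filter, Finset.mem_univ, true_and] at hi hmin
  obtain ⟨i, hi, hmax⟩ := Finset.exists_max_image (shortCoroots b J)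
    (fun i => (inner ℝ (R.coroot i) b.heightVec : ℝ)) ⟨i, mem_shortCoroots.mpr ⟨hi, hmin⟩⟩
  refine ⟨i, hi, fun k hk => ?_⟩
  obtain ⟨n, hn⟩ := hR.exists_int_inner (b.idx k) i
  rw [real_inner_comm] at hn
  have h1 := hmax _ (reflectionPerm_mem_shortCoroots hR hk hi)
  rw [hR.coroot_reflectionPerm, hR.reflection_apply_coroot, inner_sub_left,
    real_inner_smul_left, hn, hR.2 (b.idx k), real_inner_smul_left] at h1
  have h2 := mul_pos (coroot_scale_pos R (b.idx k)) (b.isPos_idx k).inner_heightVec_pos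
  have h3 : (0 : ℝ) ≤ n := by
    by_contra! hneg
    nlinarith
  lift n to ℕ using (by exact_mod_cast h3)
  exact ⟨n, by simpa using hn⟩

/-- If the ground polynomial is non-negative on dominant vectors and vanishes at one of them, then
it is non-negative at all translates of this vector by shortest coroots. -/
lemma groundPoly_add_coroot_nonneg {p t : ι → ℝ} (h : Admissible R p t)
    (hnonneg : ∀ x, IsDominantOn b J x → 0 ≤ groundPoly b J p t x) {x : E}
    (hx : IsDominantOn b J x) (hx0 : groundPoly b J p t x = 0) {i : ι}
    (hi : i ∈ shortCoroots b J) : 0 ≤ groundPoly b J p t (x + R.coroot i) := by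
  classical
  by_contra! hneg
  -- Among the shortest coroots at which the value is negative, take one of maximal height.
  obtain ⟨i, hmem, hmax⟩ := Finset.exists_max_image
    ((shortCoroots b J).filter fun i => groundPoly b J p t (x + R.coroot i) < 0)
    (fun i => (inner ℝ (R.coroot i) b.heightVec : ℝ)) ⟨i, by simp [hi, hneg]⟩
  rw [Finset.mem_filter] at hmem
  obtain ⟨hi, hneg⟩ := hmem
  -- A simple root `α_j` on which `x + α_i^∨` is negative.
  have hnd : ¬ IsDominantOn b J (x + R.coroot i) := fun hd => (hnonneg _ hd).not_gt hneg
  obtain ⟨j, hj, m, n, hm, hn, hmn⟩ : ∃ j ∈ J, ∃ m : ℕ, ∃ n : ℤ,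
      inner ℝ x (R.root (b.idx j)) = (m : ℝ) ∧
      inner ℝ (R.coroot i) (R.root (b.idx j)) = (n : ℝ) ∧ (m : ℤ) + n < 0 := by
    by_contra! hall
    refine hnd fun k hk => ?_
    obtain ⟨m, hm⟩ := hx k hk
    obtain ⟨n, hn⟩ := hR.exists_int_inner (b.idx k) i
    rw [real_inner_comm] at hn
    have h1 := hall k hk m n hm hn
    obtain ⟨l, hl⟩ := Int.eq_ofNat_of_zero_le h1
    refine ⟨l, ?_⟩
    rw [inner_add_left, hm, hn]
    exact_mod_cast hl
  have hij := reflectionPerm_mem_shortCoroots hR hj hi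
  have hcoroot : R.coroot (R.reflectionPerm (b.idx j) i) =
      R.coroot i - (n : ℝ) • R.coroot (b.idx j) := by
    rw [hR.coroot_reflectionPerm, hR.reflection_apply_coroot, hn]
  -- The reflected coroot is higher than `α_i^∨`, so the value there is non-negative.
  have hrefl : 0 ≤ groundPoly b J p t (x + (R.coroot i - (n : ℝ) • R.coroot (b.idx j))) := by
    by_contra! hneg'
    have h1 := hmax _ (Finset.mem_filter.mpr ⟨hij, by rwa [hcoroot]⟩)
    rw [hcoroot, inner_sub_left, real_inner_smul_left, hR.2 (b.idx j), real_inner_smul_left] at h1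
    have h2 := mul_pos (coroot_scale_pos R (b.idx j)) (b.isPos_idx j).inner_heightVec_pos
    have h3 : (n : ℝ) < 0 := by
      have : n < 0 := by omega
      exact_mod_cast this
    nlinarith
  have ht := h.t_nonneg (b.idx j)
  -- Straightening expresses the value at `x + α_i^∨` by the value at the reflected coroot and by
  -- values which vanish, either because they are values at `x` or because `p_j = 0`.
  by_cases hn2 : n ≤ -2
  · have hopp : R.coroot i = -R.coroot (b.idx j) :=
      coroot_eq_neg_of_inner_le hR hi (SimpleRoots.mem_idx hj) (by
        rw [hn]; exact_mod_cast hn2)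
    have hn' : n = -2 := by
      have h1 := hR.inner_root_coroot_self (b.idx j)
      rw [real_inner_comm] at h1
      rw [hopp, inner_neg_left, h1] at hn
      exact_mod_cast hn.symm
    -- `2 α_j` is not a root, since its coroot would be shorter than `α_j^∨`.
    have hp : p (b.idx j) = 0 := by
      refine h.p_eq_zero _ fun ⟨k, hk⟩ => ?_
      have h1 := (mem_shortCoroots.mp hi).2 k ((SimpleRoots.mem_idx hj).smul hk)
      rw [(hR.coroot_of_root_eq_smul hk).2, hopp, norm_neg, norm_smul] at h1
      have h2 : 0 < ‖R.coroot (b.idx j)‖ := norm_pos_iff.mpr (R.ne_zero' _)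
      norm_num at h1
      linarith
    have hback : x + R.coroot i + R.coroot (b.idx j) = x := by rw [hopp]; module
    obtain hm0 | hm1 : m = 0 ∨ m = 1 := by omega
    · have h1 := groundPoly_of_inner_eq_neg_two (b := b) hR h hj hp (x := x + R.coroot i) (by
        rw [inner_add_left, hm, hn, hm0, hn']; norm_num)
      rw [hback, hx0, mul_zero, sub_zero] at h1
      rw [h1] at hneg
      have h2 : x + R.coroot i + (2 : ℝ) • R.coroot (b.idx j) =
          x + (R.coroot i - (n : ℝ) • R.coroot (b.idx j)) := by rw [hn']; push_cast; module
      rw [h2] at hneg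
      exact (mul_nonneg ht hrefl).not_gt hneg
    · have h1 := groundPoly_of_inner_eq_neg_one (b := b) hR h hj (x := x + R.coroot i) (by
        rw [inner_add_left, hm, hn, hm1, hn']; norm_num)
      rw [hback, hx0, hp] at h1
      linarith
  · have hn' : n = -1 := by omega
    have hm0 : m = 0 := by omega
    have h1 := groundPoly_of_inner_eq_neg_one (b := b) hR h hj (x := x + R.coroot i) (by
      rw [inner_add_left, hm, hn, hm0, hn']; norm_num)
    have h2 : p (b.idx j) *
        groundPoly b J p t (x + R.coroot i + (1 / 2 : ℝ) • R.coroot (b.idx j)) = 0 := by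
      by_cases h2r : (2 : ℝ) • R.root (b.idx j) ∈ Set.range R.root
      -- If `2 α_j` is a root, then `α_i^∨` pairs to `-2` with it, so that `α_i^∨ = -α_j^∨ / 2`.
      · obtain ⟨k, hk⟩ := h2r
        have hopp := coroot_eq_neg_of_inner_le hR hi ((SimpleRoots.mem_idx hj).smul hk) (by
          rw [hk, real_inner_smul_right, hn, hn']; norm_num)
        have : x + R.coroot i + (1 / 2 : ℝ) • R.coroot (b.idx j) = x := by
          rw [hopp, (hR.coroot_of_root_eq_smul hk).2]; module
        rw [this, hx0, mul_zero]
      · rw [h.p_eq_zero _ h2r, zero_mul]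
    rw [h2, sub_zero] at h1
    rw [h1] at hneg
    have h3 : x + R.coroot i + R.coroot (b.idx j) =
        x + (R.coroot i - (n : ℝ) • R.coroot (b.idx j)) := by rw [hn']; push_cast; module
    rw [h3] at hneg
    exact (mul_nonneg ht hrefl).not_gt hneg

/-- Non-negativity on dominant vectors implies positivity: a zero would propagate along a dominant
shortest coroot, in contradiction with the asymptotics. -/
lemma groundPoly_pos_of_nonneg {p t : ι → ℝ} (h : Admissible R p t) (hJ : J.Nonempty)
    (hsub : ∀ K ⊂ J, ∀ x, IsDominantOn b K x → 0 < groundPoly b K p t x)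
    (hnonneg : ∀ x, IsDominantOn b J x → 0 ≤ groundPoly b J p t x) {x : E}
    (hx : IsDominantOn b J x) : 0 < groundPoly b J p t x := by
  classical
  refine (hnonneg x hx).lt_of_ne' fun hx0 => ?_
  obtain ⟨i, hi, hdom⟩ := exists_dominant_shortCoroot (b := b) hR hJ
  have hstep : ∀ y, IsDominantOn b J y → groundPoly b J p t y = 0 →
      groundPoly b J p t (y + R.coroot i) = 0 := by
    intro y hy hy0
    have h1 := sum_groundPoly_add_coroot (b := b) (J := J) hR p t
      (fun j hj i => reflectionPerm_mem_shortCoroots hR hj) y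
    rw [hy0, mul_zero] at h1
    exact (Finset.sum_eq_zero_iff_of_nonneg fun k hk =>
      groundPoly_add_coroot_nonneg hR h hnonneg hy hy0 hk).mp h1 i hi
  have hline : ∀ n : ℕ, IsDominantOn b J (x + (n : ℝ) • R.coroot i) ∧
      groundPoly b J p t (x + (n : ℝ) • R.coroot i) = 0 := by
    intro n
    induction n with
    | zero => simpa using ⟨hx, hx0⟩
    | succ n ih =>
      have h1 : x + ((n + 1 : ℕ) : ℝ) • R.coroot i = x + (n : ℝ) • R.coroot i + R.coroot i := by
        push_cast; module
      rw [h1]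
      refine ⟨fun k hk => ?_, hstep _ ih.1 ih.2⟩
      obtain ⟨m, hm⟩ := ih.1 k hk
      obtain ⟨l, hl⟩ := hdom k hk
      exact ⟨m + l, by rw [inner_add_left, hm, hl]; push_cast; rfl⟩
  -- Along the line `x + n α_i^∨` the coordinates in `K` are constant and the others tend to infinity.
  set K := J.filter fun k => inner ℝ (R.coroot i) (R.root (b.idx k)) = (0 : ℝ) with hKdef
  have hKJ : K ⊂ J := by
    refine Finset.filter_ssubset.mpr ?_
    by_contra! hall
    have h1 := hR.inner_root_coroot_self i
    rw [real_inner_comm, (mem_shortCoroots.mp hi).1.inner_eq_sum,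
      Finset.sum_eq_zero fun k hk => by rw [hall k hk, mul_zero]] at h1
    norm_num at h1
  have hconst : ∀ n : ℕ, ∀ k ∈ K, (inner ℝ (x + (n : ℝ) • R.coroot i) (R.root (b.idx k)) : ℝ) =
      inner ℝ x (R.root (b.idx k)) := by
    intro n k hk
    rw [inner_add_left, real_inner_smul_left, (Finset.mem_filter.mp hk).2, mul_zero, add_zero]
  have hlim := tendsto_groundPoly_div_sub (b := b) hR (T := ℕ) (l := atTop) (p := fun _ => p)
    (t := fun _ => t) (x := fun n => x + (n : ℝ) • R.coroot i) hKJ.subset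
    (fun _ => tendsto_const_nhds) (fun _ => tendsto_const_nhds) (fun _ => h.p_invariant)
    (fun _ => h.t_invariant)
    (fun k hk => by
      simp only [hconst _ k hk]
      exact Asymptotics.isBigO_const_const _ one_ne_zero _)
    (fun k hk => by
      rw [Finset.mem_sdiff, mem_posIndiv, mem_posIndiv, not_and] at hk
      obtain ⟨l, hlJ, hlK, hl⟩ := hk.1.2.exists_of_not_mem (hk.2 hk.1.1) hk.1.1.1
      have hpos : (0 : ℝ) < inner ℝ (R.coroot i) (R.coroot k) := by
        rw [hR.inner_coroot, hk.1.2.inner_eq_sum (R.coroot i)]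
        have hnn : ∀ l ∈ J, (0 : ℝ) ≤ inner ℝ (R.coroot i) (R.root (b.idx l)) := fun l hl => by
          obtain ⟨m, hm⟩ := hdom l hl
          simp [hm]
        refine mul_pos (coroot_scale_pos R k) (Finset.sum_pos' (fun l hl =>
          mul_nonneg (hk.1.1.1.repr_nonneg l) (hnn l hl)) ⟨l, hlJ, mul_pos hl ?_⟩)
        refine (hnn l hlJ).lt_of_ne' fun h0 => hlK ?_
        exact Finset.mem_filter.mpr ⟨hlJ, h0⟩
      simp only [inner_add_left, real_inner_smul_left]
      exact tendsto_atTop_add_const_left _ _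
        (tendsto_natCast_atTop_atTop.atTop_mul_const hpos))
  have hK0 : ∀ n : ℕ, groundPoly b K p t (x + (n : ℝ) • R.coroot i) = groundPoly b K p t x :=
    fun n => groundPoly_congr hR p t (hconst n)
  simp only [(hline _).2, hK0, zero_div, zero_sub] at hlim
  have h1 := tendsto_nhds_unique hlim tendsto_const_nhds
  have h2 := mul_pos (h.prod_pos (posIndiv b J \ posIndiv b K))
    (hsub K hKJ x fun k hk => hx k (hKJ.subset hk))
  linarith

end Positivity

end Ground

/-! ### Deformation of the parameters -/

section Deformation

variable [FiniteDimensional ℝ E] [Fintype ι] {b : SimpleRoots R I} {J K : Finset I}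
variable (hR : IsEuclidean R) [R.IsCrystallographic]

omit [FiniteDimensional ℝ E] [Fintype ι] [R.IsCrystallographic] in
lemma shift_symbol_zero (S : Finset ι) (f : E → ℝ) (x : E) :
    shift (symbol R (fun _ => 0) (fun _ => 0) S) f x =
      f (x + ∑ i ∈ S, (1 / 2 : ℝ) • R.coroot i) := by
  classical
  induction S using Finset.induction_on generalizing x with
  | empty => simp [symbol]
  | insert i S hi ih =>
    have : symbol R (fun _ => 0) (fun _ => 0) (insert i S) =
        rootOp R (fun _ => 0) (fun _ => 0) i * symbol R (fun _ => 0) (fun _ => 0) S :=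
      Finset.prod_insert hi
    rw [this, shift_mul_apply, shift_rootOp, ih, Finset.sum_insert hi]
    simp [add_assoc]

include hR

/-- The half sum of the coroots of `Φ_J⁺⁺` pairs to `1` with the simple roots of `J`. -/
lemma inner_half_sum_coroot {j : I} (hj : j ∈ J) :
    (inner ℝ (∑ i ∈ posIndiv b J, (1 / 2 : ℝ) • R.coroot i) (R.root (b.idx j)) : ℝ) = 1 := by
  classical
  rw [← Finset.add_sum_erase _ _ (idx_mem_posIndiv hj), inner_add_left, real_inner_smul_left]
  set r := ∑ i ∈ (posIndiv b J).erase (b.idx j), (1 / 2 : ℝ) • R.coroot i with hr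
  have h1 : R.reflection (b.idx j) r = r := by
    rw [hr, map_sum]
    refine Finset.sum_nbij' (R.reflectionPerm (b.idx j)) (R.reflectionPerm (b.idx j))
      (fun i => reflectionPerm_mem_erase hR hj) (fun i => reflectionPerm_mem_erase hR hj)
      (fun i _ => R.reflectionPerm_self _ i) (fun i _ => R.reflectionPerm_self _ i)
      fun i _ => ?_
    rw [map_smul, hR.coroot_reflectionPerm]
  have h2 := hR.inner_reflection_left (b.idx j) r (R.root (b.idx j))
  rw [h1, R.reflection_apply_self, inner_neg_right] at h2
  have h3 := hR.inner_root_coroot_self (b.idx j)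
  rw [real_inner_comm] at h3
  rw [h3]
  linarith

variable [Fintype I]

/-- Positivity on dominant vectors is an open condition along the deformation of the parameters. -/
lemma eventually_groundPoly_nonneg {p t : ι → ℝ} (h : Admissible R p t) {s₀ : ℝ}
    (h0 : 0 ≤ s₀) (h1 : s₀ ≤ 1)
    (hpos : ∀ K ⊆ J, ∀ x, IsDominantOn b K x →
      0 < groundPoly b K (fun i => s₀ * p i) (fun i => s₀ ^ 2 * t i) x) :
    ∀ᶠ s in 𝓝 s₀, ∀ x, IsDominantOn b J x →
      0 ≤ groundPoly b J (fun i => s * p i) (fun i => s ^ 2 * t i) x := by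
  classical
  by_contra hcon
  rw [not_eventually] at hcon
  push Not at hcon
  -- Counterexamples `x s` with `s → s₀`, along an ultrafilter: each coordinate is then either
  -- constant or tends to infinity.
  have hchoice : ∀ s : ℝ, ∃ x, (∃ y, IsDominantOn b J y ∧
      groundPoly b J (fun i => s * p i) (fun i => s ^ 2 * t i) y < 0) →
      IsDominantOn b J x ∧ groundPoly b J (fun i => s * p i) (fun i => s ^ 2 * t i) x < 0 := by
    intro s
    by_cases hs : ∃ y, IsDominantOn b J y ∧
      groundPoly b J (fun i => s * p i) (fun i => s ^ 2 * t i) y < 0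
    · exact ⟨hs.choose, fun _ => hs.choose_spec⟩
    · exact ⟨0, fun h => absurd h hs⟩
  choose x hx using hchoice
  have hne := frequently_iff_neBot.mp hcon
  set U := Ultrafilter.of (𝓝 s₀ ⊓ 𝓟 {s | ∃ y, IsDominantOn b J y ∧
    groundPoly b J (fun i => s * p i) (fun i => s ^ 2 * t i) y < 0}) with hU
  have hUle := Ultrafilter.of_le (𝓝 s₀ ⊓ 𝓟 {s | ∃ y, IsDominantOn b J y ∧
    groundPoly b J (fun i => s * p i) (fun i => s ^ 2 * t i) y < 0})
  have hUs : Tendsto (fun s : ℝ => s) (U : Filter ℝ) (𝓝 s₀) := hUle.trans inf_le_left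
  have hUx : ∀ᶠ s in (U : Filter ℝ), IsDominantOn b J (x s) ∧
      groundPoly b J (fun i => s * p i) (fun i => s ^ 2 * t i) (x s) < 0 := by
    have : ∀ᶠ s in (U : Filter ℝ), ∃ y, IsDominantOn b J y ∧
        groundPoly b J (fun i => s * p i) (fun i => s ^ 2 * t i) y < 0 :=
      (hUle.trans inf_le_right) (mem_principal_self _)
    exact this.mono hx
  set K := J.filter fun k =>
    ¬ Tendsto (fun s => (inner ℝ (x s) (R.root (b.idx k)) : ℝ)) U atTop with hKdef
  have hKJ : K ⊆ J := Finset.filter_subset _ _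
  have hconst : ∀ k ∈ K, ∃ m : ℕ, ∀ᶠ s in (U : Filter ℝ),
      inner ℝ (x s) (R.root (b.idx k)) = (m : ℝ) := by
    intro k hk
    obtain ⟨hkJ, hk⟩ := Finset.mem_filter.mp hk
    rw [tendsto_atTop] at hk
    push Not at hk
    obtain ⟨C, hC⟩ := hk
    have h2 : (⋃ m ∈ (Finset.range (⌈C⌉₊ + 1) : Set ℕ),
        {s | inner ℝ (x s) (R.root (b.idx k)) = (m : ℝ)}) ∈ U := by
      filter_upwards [hUx, hC] with s hs hsC
      obtain ⟨m, hm⟩ := hs.1 k hkJ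
      simp only [Set.mem_iUnion, Set.mem_ofPred_eq]
      refine ⟨m, ?_, hm⟩
      rw [hm] at hsC
      have : (m : ℝ) < ⌈C⌉₊ := hsC.trans_le (Nat.le_ceil C)
      have : m < ⌈C⌉₊ := by exact_mod_cast this
      simp; omega
    obtain ⟨m, -, hm⟩ := (Ultrafilter.finite_biUnion_mem_iff (Finset.finite_toSet _)).mp h2
    exact ⟨m, hm⟩
  choose! m hm using hconst
  set y : E := ∑ k ∈ K, (m k : ℝ) • b.coweight k with hy
  have hyk : ∀ k ∈ K, inner ℝ y (R.root (b.idx k)) = (m k : ℝ) := by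
    intro k hk
    rw [hy, sum_inner]
    simp only [real_inner_smul_left, b.inner_coweight]
    simp [hk]
  have hxy : ∀ᶠ s in (U : Filter ℝ), ∀ k ∈ K,
      (inner ℝ (x s) (R.root (b.idx k)) : ℝ) = inner ℝ y (R.root (b.idx k)) := by
    rw [eventually_all_finset]
    intro k hk
    filter_upwards [hm k hk] with s hs
    rw [hs, hyk k hk]
  have hinf : ∀ i ∈ posIndiv b J \ posIndiv b K,
      Tendsto (fun s => (inner ℝ (x s) (R.coroot i) : ℝ)) U atTop := by
    intro i hi
    rw [Finset.mem_sdiff, mem_posIndiv, mem_posIndiv, not_and] at hi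
    obtain ⟨k, hkJ, hkK, hk⟩ := hi.1.2.exists_of_not_mem (hi.2 hi.1.1) hi.1.1.1
    have hkt : Tendsto (fun s => (inner ℝ (x s) (R.root (b.idx k)) : ℝ)) U atTop := by
      by_contra hcon
      exact hkK (Finset.mem_filter.mpr ⟨hkJ, hcon⟩)
    simp only [hR.inner_coroot]
    refine Tendsto.const_mul_atTop (coroot_scale_pos R i)
      (tendsto_atTop_mono' _ ?_ (hkt.const_mul_atTop hk))
    filter_upwards [hUx] with s hs
    rw [hi.1.2.inner_eq_sum]
    refine Finset.single_le_sum (f := fun k => b.basis.repr (R.root i) k *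
      inner ℝ (x s) (R.root (b.idx k))) (fun l hl => ?_) hkJ
    obtain ⟨n, hn⟩ := hs.1 l hl
    rw [hn]
    exact mul_nonneg (hi.1.1.1.repr_nonneg l) n.cast_nonneg
  have hps : ∀ i, Tendsto (fun s => s * p i) U (𝓝 (s₀ * p i)) := fun i => hUs.mul_const _
  have hts : ∀ i, Tendsto (fun s => s ^ 2 * t i) U (𝓝 (s₀ ^ 2 * t i)) :=
    fun i => (hUs.pow 2).mul_const _
  have hlim := tendsto_groundPoly_div_sub (b := b) hR (T := ℝ) (l := U)
    (p := fun s i => s * p i) (t := fun s i => s ^ 2 * t i) (x := x) hKJ hps hts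
    (fun s i j => by rw [h.p_invariant]) (fun s i j => by rw [h.t_invariant])
    (fun k hk => by
      refine (Asymptotics.isBigO_const_const (m k : ℝ) one_ne_zero _).congr' ?_ EventuallyEq.rfl
      filter_upwards [hm k hk] with s hs
      exact hs.symm) hinf
  have hlimK : Tendsto (fun s => groundPoly b K (fun i => s * p i) (fun i => s ^ 2 * t i) (x s)) U
      (𝓝 (groundPoly b K (fun i => s₀ * p i) (fun i => s₀ ^ 2 * t i) y)) := by
    refine Tendsto.congr' ?_ (tendsto_shift_symbol (R := R) hps hts
      (fun z => tendsto_const_nhds (x := delta b K z)) (posIndiv b K) y)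
    filter_upwards [hxy] with s hs
    exact (groundPoly_congr hR _ _ hs).symm
  have hlimM : Tendsto (fun s => ∏ i ∈ posIndiv b J \ posIndiv b K, (1 + s * p i - s ^ 2 * t i)) U
      (𝓝 (∏ i ∈ posIndiv b J \ posIndiv b K, (1 + s₀ * p i - s₀ ^ 2 * t i))) :=
    tendsto_finsetProd _ fun i _ => ((hps i).const_add 1).sub (hts i)
  have hsum := hlim.add (hlimM.mul hlimK)
  simp only [sub_add_cancel, zero_add] at hsum
  have hposlim := mul_pos ((h.scale h0 h1).prod_pos (posIndiv b J \ posIndiv b K))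
    (hpos K hKJ y fun k hk => ⟨m k, hyk k hk⟩)
  have hDpos : ∀ᶠ s in (U : Filter ℝ),
      0 < ∏ i ∈ posIndiv b J \ posIndiv b K, (inner ℝ (x s) (R.coroot i) : ℝ) := by
    have : ∀ᶠ s in (U : Filter ℝ), ∀ i ∈ posIndiv b J \ posIndiv b K,
        (0 : ℝ) < inner ℝ (x s) (R.coroot i) := by
      rw [eventually_all_finset]
      exact fun i hi => (hinf i hi).eventually_gt_atTop 0
    exact this.mono fun s hs => Finset.prod_pos hs
  obtain ⟨s, hs1, hs2, hs3⟩ := ((hsum.eventually_const_lt hposlim).and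
    (hDpos.and hUx)).exists
  exact (div_neg_of_neg_of_pos hs3.2 hs2).not_gt hs1

/-- The ground polynomials are positive on dominant integral vectors. The parameters are deformed to
zero, where the polynomial is a translate of the product of the coroots by a dominant vector. -/
theorem groundPoly_pos {p t : ι → ℝ} (h : Admissible R p t) (J : Finset I) (x : E)
    (hx : IsDominantOn b J x) : 0 < groundPoly b J p t x := by
  classical
  induction J using Finset.strongInduction generalizing p t x with
  | H J ih =>
  rcases J.eq_empty_or_nonempty with rfl | hJ
  · have hempty : posIndiv b ∅ = ∅ := by
      refine Finset.eq_empty_of_forall_notMem fun i hi => ?_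
      rw [mem_posIndiv] at hi
      obtain ⟨k, hk⟩ := hi.1.1.exists_repr_pos
      exact hk.ne' (SimpleRoots.mem_iff.mp hi.2 k (Finset.notMem_empty k))
    simp [groundPoly, symbol, delta, hempty]
  set S : Set ℝ := {s | ∀ x, IsDominantOn b J x →
    0 ≤ groundPoly b J (fun i => s * p i) (fun i => s ^ 2 * t i) x} with hS
  have hstrict : ∀ s ∈ Set.Icc (0 : ℝ) 1, s ∈ S → ∀ x, IsDominantOn b J x →
      0 < groundPoly b J (fun i => s * p i) (fun i => s ^ 2 * t i) x := by
    intro s hs hsS x hx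
    have hadm := h.scale hs.1 hs.2
    exact groundPoly_pos_of_nonneg hR hadm hJ (fun K hK x hx => ih K hK hadm x hx) hsS hx
  have hclosed : IsClosed (S ∩ Set.Icc 0 1) := by
    refine IsClosed.inter ?_ isClosed_Icc
    have : S = ⋂ x, ⋂ (_ : IsDominantOn b J x),
        {s | 0 ≤ groundPoly b J (fun i => s * p i) (fun i => s ^ 2 * t i) x} := by
      ext s; simp [hS]
    rw [this]
    refine isClosed_iInter fun x => isClosed_iInter fun _ =>
      isClosed_le continuous_const (continuous_iff_continuousAt.mpr fun s => ?_)
    exact tendsto_shift_symbol (R := R) (fun i => tendsto_id.mul_const (p i))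
      (fun i => (tendsto_id.pow 2).mul_const (t i))
      (fun z => tendsto_const_nhds (x := delta b J z)) (posIndiv b J) x
  have hzero : (0 : ℝ) ∈ S := by
    intro x hx
    have h1 : groundPoly b J (fun i => 0 * p i) (fun i => 0 ^ 2 * t i) x =
        delta b J (x + ∑ i ∈ posIndiv b J, (1 / 2 : ℝ) • R.coroot i) := by
      rw [← shift_symbol_zero (posIndiv b J) (delta b J) x]
      simp [groundPoly]
    rw [h1]
    refine (delta_pos hR fun k hk => ?_).le
    obtain ⟨n, hn⟩ := hx k hk
    rw [inner_add_left, hn, inner_half_sum_coroot hR hk]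
    positivity
  have hsub : Set.Icc (0 : ℝ) 1 ⊆ S := by
    refine hclosed.Icc_subset_of_forall_mem_nhdsWithin hzero fun s hs => ?_
    refine mem_nhdsWithin_of_mem_nhds
      (eventually_groundPoly_nonneg hR h hs.2.1 hs.2.2.le fun K hK y hy => ?_)
    rcases hK.eq_or_ssubset with rfl | hK
    · exact hstrict s ⟨hs.2.1, hs.2.2.le⟩ hs.1 y hy
    · exact ih K hK (h.scale hs.2.1 hs.2.2.le) y hy
  have h1 := hstrict 1 ⟨zero_le_one, le_rfl⟩ (hsub ⟨zero_le_one, le_rfl⟩) x hx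
  simpa using h1

end Deformation

/-! ### The parameters of the `c`-function -/

/-- For the numerator `(1 - a X) (1 + b X)` of the factor of the `c`-function at a root, the
number `b - a`. -/
def cSub (R : RootPairing ι ℝ E E) (q : E → ℝ) (i : ι) : ℝ :=
  tau R q (R.root i) ^ (-(1 / 2) : ℝ) * (1 - (tau R q ((2 : ℝ) • R.root i))⁻¹)

/-- For the numerator `(1 - a X) (1 + b X)` of the factor of the `c`-function at a root, the
number `a b`. -/
def cMul (R : RootPairing ι ℝ E E) (q : E → ℝ) (i : ι) : ℝ :=
  (tau R q ((2 : ℝ) • R.root i))⁻¹ * (tau R q (R.root i) ^ (-(1 / 2) : ℝ)) ^ 2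

lemma cFactor_eq (q : E → ℝ) (i : ι) (θ : E) : cFactor R q i θ =
    evalExp θ (rootOp R (cSub R q) (cMul R q) i) / sinhHalf (inner ℝ θ (R.coroot i)) := by
  rw [evalExp_rootOp, cFactor, sinhHalf, cSub, cMul]
  set u : ℝ := inner ℝ θ (R.coroot i)
  set B := tau R q (R.root i) ^ (-(1 / 2) : ℝ)
  set A := (tau R q ((2 : ℝ) • R.root i))⁻¹
  have h1 : Real.exp (-u) = Real.exp (-(u / 2)) * Real.exp (-(u / 2)) := by
    rw [← Real.exp_add]; ring_nf
  have h2 : Real.exp (-(u / 2)) * Real.exp (u / 2) = 1 := by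
    rw [← Real.exp_add]; simp
  have h3 : -(1 / 2) * u = -(u / 2) := by ring
  rw [h1, h3, ← mul_div_mul_left _ (Real.exp (u / 2) - _) (Real.exp_ne_zero (-(u / 2)))]
  congr 1
  · linear_combination -h2
  · linear_combination -h2

lemma reflection_mem_range_root (j : ι) (v : E) :
    R.reflection j v ∈ Set.range R.root ↔ v ∈ Set.range R.root := by
  refine ⟨fun ⟨i, hi⟩ => ⟨R.reflectionPerm j i, ?_⟩, fun ⟨i, hi⟩ => ⟨R.reflectionPerm j i, ?_⟩⟩
  · rw [R.root_reflectionPerm, hi, R.reflection_same]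
  · rw [R.root_reflectionPerm, hi]

section Parameters

variable {q : E → ℝ} (hq : IsParam R q)
include hq

lemma tau_reflection (j : ι) (v : E) : tau R q (R.reflection j v) = tau R q v := by
  have hqv : ∀ v ∈ Set.range R.root, q (R.reflection j v) = q v := by
    rintro _ ⟨i, rfl⟩
    exact hq.invariant i j
  have hmem : ∀ c : ℝ, c • R.reflection j v ∈ Set.range R.root ↔ c • v ∈ Set.range R.root :=
    fun c => by rw [← map_smul, reflection_mem_range_root]
  rw [tau, tau, reflection_mem_range_root, hmem, hmem]
  split_ifs with h1 h2 h3
  · exact hqv v h1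
  · rw [hqv v h1, ← map_smul, hqv _ h3]
  · exact hqv v h1
  · rfl

lemma tau_two_smul_of_mem {i : ι} (h : (2 : ℝ) • R.root i ∈ Set.range R.root) :
    tau R q ((2 : ℝ) • R.root i) = q ((2 : ℝ) • R.root i) ∧ 1 < q ((2 : ℝ) • R.root i) := by
  refine ⟨?_, ?_⟩
  · have h1 : (1 / 2 : ℝ) • (2 : ℝ) • R.root i = R.root i := by rw [smul_smul]; norm_num
    rw [tau, if_neg (not_not.mpr h), h1, if_pos ⟨i, rfl⟩]
  · obtain ⟨k, hk⟩ := h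
    rw [← hk]
    exact hq.one_lt k

omit hq in
lemma tau_two_smul_of_notMem {i : ι} (h : (2 : ℝ) • R.root i ∉ Set.range R.root) :
    tau R q ((2 : ℝ) • R.root i) = 1 := by
  rw [tau, if_pos h]

lemma one_le_tau_two_smul (i : ι) : 1 ≤ tau R q ((2 : ℝ) • R.root i) := by
  by_cases h : (2 : ℝ) • R.root i ∈ Set.range R.root
  · rw [(tau_two_smul_of_mem hq h).1]
    exact (tau_two_smul_of_mem hq h).2.le
  · rw [tau_two_smul_of_notMem h]

lemma tau_root_pos (i : ι) : 0 < tau R q (R.root i) := by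
  have h1 := hq.one_lt i
  rw [tau, if_neg (not_not.mpr ⟨i, rfl⟩)]
  split_ifs with h2 h3
  · linarith
  · have := (tau_two_smul_of_mem hq h3).2
    positivity
  · linarith

lemma one_lt_tau_mul (i : ι) :
    1 < tau R q ((2 : ℝ) • R.root i) ^ 2 * tau R q (R.root i) := by
  have h1 := hq.one_lt i
  by_cases h : (2 : ℝ) • R.root i ∈ Set.range R.root
  · obtain ⟨h2, h3⟩ := tau_two_smul_of_mem hq h
    rw [h2, tau, if_neg (not_not.mpr ⟨i, rfl⟩), if_pos h]
    split_ifs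
    · exact one_lt_mul_of_lt_of_le (one_lt_pow₀ h3 two_ne_zero) h1.le
    · have h4 : q ((2 : ℝ) • R.root i) ^ 2 * (q (R.root i) / q ((2 : ℝ) • R.root i)) =
          q ((2 : ℝ) • R.root i) * q (R.root i) := by
        have : q ((2 : ℝ) • R.root i) ≠ 0 := by linarith
        field_simp
      rw [h4]
      exact one_lt_mul_of_lt_of_le h3 h1.le
  · rw [tau_two_smul_of_notMem h, tau, if_neg (not_not.mpr ⟨i, rfl⟩), if_neg h, ite_self]
    linarith

lemma admissible_cFun : Admissible R (cSub R q) (cMul R q) where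
  p_invariant i j := by
    rw [cSub, cSub, R.root_reflectionPerm, ← map_smul, tau_reflection hq, tau_reflection hq]
  t_invariant i j := by
    rw [cMul, cMul, R.root_reflectionPerm, ← map_smul, tau_reflection hq, tau_reflection hq]
  p_nonneg i := mul_nonneg (Real.rpow_nonneg (tau_root_pos hq i).le _)
    (sub_nonneg.mpr (inv_le_one_of_one_le₀ (one_le_tau_two_smul hq i)))
  t_nonneg i := mul_nonneg
    (inv_nonneg.mpr (zero_le_one.trans (one_le_tau_two_smul hq i))) (sq_nonneg _)
  t_lt i := by
    have h1 := tau_root_pos hq i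
    have h2 := zero_lt_one.trans_le (one_le_tau_two_smul hq i)
    set B := tau R q (R.root i) ^ (-(1 / 2) : ℝ) with hB
    have hB0 : 0 < B := Real.rpow_pos_of_pos h1 _
    have hB2 : B ^ 2 = (tau R q (R.root i))⁻¹ := by
      rw [hB, ← Real.rpow_natCast, ← Real.rpow_mul h1.le, ← Real.rpow_neg_one]
      norm_num
    have h3 : B < tau R q ((2 : ℝ) • R.root i) := by
      refine lt_of_pow_lt_pow_left₀ 2 h2.le ?_
      rw [hB2, inv_lt_iff_one_lt_mul₀ h1]
      exact one_lt_tau_mul hq i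
    have h4 : (tau R q ((2 : ℝ) • R.root i))⁻¹ * B < 1 := by
      rw [inv_mul_lt_iff₀ h2, mul_one]
      exact h3
    have h5 := mul_pos (sub_pos.mpr h4) (add_pos one_pos hB0)
    rw [cSub, cMul, ← hB]
    linarith
  p_eq_zero i hi := by
    rw [cSub, tau_two_smul_of_notMem hi]; simp

end Parameters

/-! ### Identification of the limits and conclusion -/

section Identification

variable [FiniteDimensional ℝ E] [Fintype ι] [Fintype I] {b : SimpleRoots R I} {J : Finset I}
  (hR : IsEuclidean R) [R.IsCrystallographic]
include hR

omit [Fintype I] in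
lemma average_eq (q : E → ℝ) (μ θ : E) : average b q J μ θ =
    (Nat.card (b.weyl J) : ℝ)⁻¹ * (shift (symbol R (cSub R q) (cMul R q) (posIndiv b J))
      (altSum b J θ) μ / ∏ i ∈ posIndiv b J, sinhHalf (inner ℝ θ (R.coroot i))) := by
  rw [average, finsum_eq_sum_of_fintype, shift_altSum, Finset.sum_div]
  congr 1
  refine Finset.sum_congr rfl fun w _ => ?_
  have h1 : cFun b q J (w.1 θ) = evalExp (w.1 θ) (symbol R (cSub R q) (cMul R q) (posIndiv b J)) /
      ∏ i ∈ posIndiv b J, sinhHalf (inner ℝ (w.1 θ) (R.coroot i)) := by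
    rw [symbol, map_prod, ← Finset.prod_div_distrib]
    exact Finset.prod_congr rfl fun i _ => cFactor_eq q i _
  have h2 := odd_weyl (b := b) (J := J)
    (f := fun θ => ∏ i ∈ posIndiv b J, sinhHalf (inner ℝ θ (R.coroot i))) hR
    (fun j hj θ => prod_odd_reflection hR sinhHalf_neg hj θ) w.2 θ
  have h3 : (sgn w.1)⁻¹ = sgn w.1 := inv_eq_of_mul_eq_one_left (sgn_mul_self hR w.2)
  rw [h1, h2, div_mul_eq_div_div_swap, div_eq_mul_inv _ (sgn w.1), h3]
  ring

/-- The averages converge, to a positive multiple of the ground polynomial. -/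
lemma exists_tendsto_average (b : SimpleRoots R I) (q : E → ℝ) (J : Finset I) :
    ∃ C : ℝ, 0 < C ∧ ∀ μ, Tendsto (average b q J μ) (𝓝[regular b J] 0)
      (𝓝 (C * groundPoly b J (cSub R q) (cMul R q) μ)) := by
  obtain ⟨c, hc, h⟩ := exists_pos_tendsto_altSum_div hR b J
  have hcard : (0 : ℝ) < Nat.card (b.weyl J) := by exact_mod_cast Nat.card_pos
  refine ⟨(Nat.card (b.weyl J) : ℝ)⁻¹ * c, mul_pos (inv_pos.mpr hcard) hc, fun μ => ?_⟩
  have h1 := tendsto_shift (symbol R (cSub R q) (cMul R q) (posIndiv b J))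
    (h₀ := c • delta b J) (h := fun θ => (delta b J θ)⁻¹ • altSum b J θ)
    (l := 𝓝[regular b J] 0) (fun x => by simpa [div_eq_inv_mul] using h x) μ
  have h2 := (h1.div (tendsto_prod_sinhHalf_div (b := b) (J := J)) one_ne_zero).const_mul
    (Nat.card (b.weyl J) : ℝ)⁻¹
  rw [map_smul, Pi.smul_apply, smul_eq_mul, div_one, ← mul_assoc] at h2
  refine h2.congr' ?_
  filter_upwards [self_mem_nhdsWithin] with θ hθ
  have hδ := delta_ne_zero_of_regular hθ
  rw [average_eq hR, Pi.div_apply, map_smul, Pi.smul_apply, smul_eq_mul]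
  congr 1
  rw [inv_mul_eq_div, div_div_div_cancel_right₀ hδ]

omit [Fintype ι] [R.IsCrystallographic] hR in
lemma SimpleRoots.IsDominant.isDominantOn {x : E} (hx : b.IsDominant x) (J : Finset I) :
    IsDominantOn b J x := by
  classical
  intro k _
  obtain ⟨hlat, c, hc, hxc⟩ := hx
  have hint : ∃ n : ℤ, inner ℝ x (R.root (b.idx k)) = (n : ℝ) := by
    refine Submodule.span_induction (p := fun x _ => ∃ n : ℤ,
      inner ℝ x (R.root (b.idx k)) = (n : ℝ)) ?_ ⟨0, by simp⟩ ?_ ?_ hlat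
    · rintro _ ⟨l, rfl⟩
      exact ⟨if l = k then 1 else 0, by rw [b.inner_coweight]; split_ifs <;> simp⟩
    · rintro x y - - ⟨m, hm⟩ ⟨n, hn⟩
      exact ⟨m + n, by rw [inner_add_left, hm, hn]; push_cast; rfl⟩
    · rintro a x - ⟨n, hn⟩
      refine ⟨a * n, ?_⟩
      rw [← Int.cast_smul_eq_zsmul ℝ, real_inner_smul_left, hn]
      push_cast; rfl
  obtain ⟨n, hn⟩ := hint
  have hnn : (0 : ℝ) ≤ inner ℝ x (R.root (b.idx k)) := by
    rw [hxc, sum_inner]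
    refine Finset.sum_nonneg fun l _ => ?_
    rw [real_inner_smul_left, b.inner_coweight]
    split_ifs <;> simp [hc]
  rw [hn] at hnn ⊢
  lift n to ℕ using (by exact_mod_cast hnn)
  exact ⟨n, by simp⟩

omit [R.IsCrystallographic] in
/-- On dominant integral vectors with bounded coordinates in `J`, the ground polynomial of `J` takes
finitely many values. -/
lemma finite_range_groundPoly (p t : ι → ℝ) {γ : ℕ → E} (hγ : ∀ n, IsDominantOn b J (γ n))
    (hbdd : ∀ k ∈ J, BddAbove (Set.range fun n => (inner ℝ (γ n) (R.root (b.idx k)) : ℝ))) :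
    (Set.range fun n => groundPoly b J p t (γ n)).Finite := by
  classical
  have hB : ∀ k, ∃ B : ℕ, k ∈ J → ∀ n, (inner ℝ (γ n) (R.root (b.idx k)) : ℝ) ≤ B := by
    intro k
    by_cases hk : k ∈ J
    · obtain ⟨C, hC⟩ := hbdd k hk
      exact ⟨⌈C⌉₊, fun _ n => (hC ⟨n, rfl⟩).trans (Nat.le_ceil C)⟩
    · exact ⟨0, fun h => absurd h hk⟩
  choose B hB using hB
  choose N hN using hγ
  refine ((Fintype.piFinset fun k => Finset.range (B k + 1)).finite_toSet.image
    fun v : I → ℕ => groundPoly b J p t (∑ k, (v k : ℝ) • b.coweight k)).subset ?_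
  rintro _ ⟨n, rfl⟩
  refine ⟨fun k => if h : k ∈ J then N n k h else 0, ?_, ?_⟩
  · simp only [Finset.mem_coe, Fintype.mem_piFinset, Finset.mem_range]
    intro k
    split_ifs with hk
    · have h1 := hB k hk n
      rw [hN n k hk] at h1
      have : N n k hk ≤ B k := by exact_mod_cast h1
      omega
    · omega
  · refine groundPoly_congr hR p t fun k hk => ?_
    rw [hN n k hk, sum_inner]
    simp only [real_inner_smul_left, b.inner_coweight]
    simp [hk]

end Identification

end GroundState
end

open Classical in
theorem mainTheorem9 {ι E I : Type*} [Fintype ι] [Fintype I]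
    [NormedAddCommGroup E] [InnerProductSpace ℝ E] [FiniteDimensional ℝ E]
    (R : RootPairing ι ℝ E E) [R.IsRootSystem] [R.IsCrystallographic] [R.IsIrreducible]
    (hR : GroundState.IsEuclidean R) (b : GroundState.SimpleRoots R I)
    (q : E → ℝ) (hq : GroundState.IsParam R q) :
    (∀ (J : Finset I), ∀ μ ∈ b.coweightLattice,
      Tendsto (GroundState.average b q J μ) (𝓝[GroundState.regular b J] 0)
        (𝓝 (GroundState.groundP b q J μ))) ∧
    ∀ J : Finset I, J ≠ Finset.univ →
      ∃ a : ℝ, 0 < a ∧ ∀ γ : ℕ → E,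
        (∀ n, b.IsDominant (γ n)) →
        (∀ i, b.IsPos i → b.Mem J i →
          BddAbove (Set.range fun n => (inner ℝ (γ n) (R.root i) : ℝ))) →
        (∀ i, b.IsPos i → ¬ b.Mem J i →
          Tendsto (fun n => (inner ℝ (γ n) (R.root i) : ℝ)) atTop atTop) →
        ∃ ε : ℕ → ℝ, Tendsto ε atTop (𝓝 0) ∧ ∀ᶠ n in atTop,
          GroundState.groundP b q Finset.univ (γ n) =
            (∏ i with b.IsPosIndiv i ∧ ¬ b.Mem J i, inner ℝ (γ n) (R.coroot i)) *
              GroundState.groundP b q J (γ n) * (a + ε n) := by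
  open GroundState in
  choose C hC hlim using exists_tendsto_average hR b q
  have hP : ∀ J μ, groundP b q J μ = C J * groundPoly b J (cSub R q) (cMul R q) μ := by
    intro J μ
    have := neBot_regular (b := b) (J := J) hR
    exact (hlim J μ).limUnder_eq
  refine ⟨fun J μ _ => by rw [hP]; exact hlim J μ, fun J _ => ?_⟩
  have hadm := admissible_cFun hq
  have hset : posIndiv b Finset.univ \ posIndiv b J =
      ({i | b.IsPosIndiv i ∧ ¬ b.Mem J i} : Finset ι) := by
    ext i
    have : b.Mem Finset.univ i := fun k hk => absurd (Finset.mem_univ k) hk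
    simp [mem_posIndiv, this]
    tauto
  set S : Finset ι := {i | b.IsPosIndiv i ∧ ¬ b.Mem J i} with hS
  set M : ℝ := ∏ i ∈ S, (1 + cSub R q i - cMul R q i) with hM
  refine ⟨C Finset.univ * M / C J,
    div_pos (mul_pos (hC _) (hadm.prod_pos _)) (hC J), fun γ hdom hbdd hinf => ?_⟩
  have hdomJ := fun n => (hdom n).isDominantOn J
  have hbddJ : ∀ k ∈ J, BddAbove (Set.range fun n => (inner ℝ (γ n) (R.root (b.idx k)) : ℝ)) :=
    fun k hk => hbdd _ (b.isPos_idx k) (SimpleRoots.mem_idx hk)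
  have hinfS : ∀ i ∈ S, Tendsto (fun n => (inner ℝ (γ n) (R.coroot i) : ℝ)) atTop atTop := by
    intro i hi
    simp only [hS, Finset.mem_filter, Finset.mem_univ, true_and] at hi
    simp only [hR.inner_coroot]
    exact (hinf i hi.1.1 hi.2).const_mul_atTop (coroot_scale_pos R i)
  have hmain := tendsto_groundPoly_div_sub (b := b) hR (T := ℕ) (l := atTop)
    (p := fun _ => cSub R q) (t := fun _ => cMul R q) (x := γ) (Finset.subset_univ J)
    (fun _ => tendsto_const_nhds) (fun _ => tendsto_const_nhds) (fun _ => hadm.p_invariant)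
    (fun _ => hadm.t_invariant)
    (fun k hk => by
      obtain ⟨B, hB⟩ := hbddJ k hk
      refine Asymptotics.IsBigO.of_bound B (Eventually.of_forall fun n => ?_)
      obtain ⟨m, hm⟩ := hdomJ n k hk
      rw [norm_one, mul_one, Real.norm_of_nonneg (by rw [hm]; positivity)]
      exact hB ⟨n, rfl⟩) (by rwa [hset])
  simp only [hset] at hmain
  -- The polynomial of `J` takes finitely many values on the sequence, all positive, so that its
  -- inverse is bounded and the absolute error may be divided by it.
  have hpos : ∀ n, 0 < groundPoly b J (cSub R q) (cMul R q) (γ n) :=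
    fun n => groundPoly_pos hR hadm J _ (hdomJ n)
  obtain ⟨B, hB⟩ := ((finite_range_groundPoly hR (cSub R q) (cMul R q) hdomJ hbddJ).image
    (fun y => y⁻¹)).bddAbove
  have hε := (bdd_le_mul_tendsto_zero' B (f := fun n =>
    (groundPoly b J (cSub R q) (cMul R q) (γ n))⁻¹) (Eventually.of_forall fun n => by
      rw [abs_of_pos (inv_pos.mpr (hpos n))]
      exact hB ⟨_, ⟨n, rfl⟩, rfl⟩) hmain).const_mul (C Finset.univ / C J)
  rw [mul_zero] at hε
  refine ⟨_, hε, ?_⟩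
  have hD : ∀ᶠ n in atTop, ∏ i ∈ S, (inner ℝ (γ n) (R.coroot i) : ℝ) ≠ 0 := by
    have : ∀ᶠ n in atTop, ∀ i ∈ S, (inner ℝ (γ n) (R.coroot i) : ℝ) ≠ 0 := by
      rw [eventually_all_finset]
      exact fun i hi => (hinfS i hi).eventually_ne_atTop 0
    exact this.mono fun n hn => Finset.prod_ne_zero_iff.mpr hn
  filter_upwards [hD] with n hn
  have h1 := (hC J).ne'
  have h2 := (hpos n).ne'
  rw [hP, hP]
  field_simp
  ring
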